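/- **Setting.** Let $S$ and $A$ be Borel spaces (state and action space), with an isolated point $x_\infty$ adjoined to $S$ and $a_\infty$ to $A$. Given are: - admissible action sets $A(x)\subseteq A$, $x\in S$, such that $K=\{(x,a):a\in A(x)\}$ is measurable and contains the graph of a measurable map $S\to A$; put $A(x_\infty)=\{a_\infty\}$; - a signed kernel $q(dy|x,a)$ on $S$ given $(x,a)\in K$ (finite signed measures), with $q(\Gamma|x,a)\ge 0$ whenever $x\notin\Gamma$, $q(S|x,a)=0$ and $\bar q_x=\sup_{a\in A(x)}q_x(a)<\infty$, where $q_x(a)=-q(\{x\}|x,a)$; - a measurable cost rate $c_0:K\to\mathbb R$. The sample space $\Omega$ consists of the sequences $\omega=(x_0,\theta_1,x_1,\theta_2,x_2,\dots)$ with $x_0\in S$ in which either all $(\theta_m,x_m)\in(0,\infty)\times S$, or this holds up to some index and all later $(\theta_m,x_m)$ equal $(\infty,x_\infty)$; it carries the trace of the product $\sigma$-algebra. Put $h_m=(x_0,\theta_1,\dots,\theta_m,x_m)$, $T_0=0$, $T_m=\theta_1+\dots+\theta_m$, $T_\infty=\lim_m T_m$, $\xi_t=x_m$ for $T_m\le t<T_{m+1}$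 and $\xi_t=x_\infty$ for $t\ge T_\infty$; $\xi_{t-}=x_m$ for $T_m<t\le T_{m+1}$, $\xi_{0-}=x_0$, and $\xi_{t-}=x_\infty$ for $t\ge T_\infty$. Let $\mathcal F_t$ be the $\sigma$-algebra generated by the events $\{T_m\le s,\ x_m\in\Gamma\}$, $s\le t$, $m\ge0$, $\Gamma\in\mathcal B(S)$, let $\mathcal F_{s-}=\bigvee_{t<s}\mathcal F_t$, and let $\mathcal P$ be the predictable $\sigma$-algebra on $\Omega\times[0,\infty)$, generated by the sets $\Gamma\times\{0\}$ ($\Gamma\in\mathcal F_0$) and $\Gamma\times(s,\infty)$ ($\Gamma\in\mathcal F_{s-}$, $s\ge0$). A (randomized history-dependent) policy $\pi$ is a $\mathcal P$-measurable transition probability $\pi(da|\omega,t)$ on $A\cup\{a_\infty\}$ concentrated on $A(\xi_{t-})$. For $T_m<t\le T_{m+1}$ it depends on $\omega$ through $h_m$ only; put $$\Lambda^m(\Gamma|h_m,u)=\int_A\pi(da|h_m,T_m+u)\,q(\Gamma\setminus\{x_m\}|x_m,a).$$ For a probability measure $\gamma$ on $S$, $P^\pi_\gamma$ is the probability measure on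 $\Omega$ under which $x_0$ has the law $\gamma$ and, given $h_m$, the pair $(\theta_{m+1},x_{m+1})$ equals $(\infty,x_\infty)$ if $\theta_m=\infty$ (with $m\ge1$), and otherwise has the law $\Lambda^m(dy|h_m,u)\,e^{-\int_0^u\Lambda^m(S|h_m,v)dv}\,du$ on $(0,\infty)\times S$ together with the mass $e^{-\int_0^\infty\Lambda^m(S|h_m,v)dv}$ at $(\infty,x_\infty)$. Write $P^\pi_x$ for $\gamma=\delta_x$, and $E^\pi_\gamma,E^\pi_x$ for the expectations. **Condition 1.** $w:S\to[1,\infty)$ is measurable, $\rho\ge0$, $b\ge0$, and $S_0\subseteq S_1\subseteq\cdots$ are measurable subsets of $S$ with: (a) $\bigcup_l S_l=S$ and $\lim_{l\to\infty}\inf_{x\in S\setminus S_l}w(x)=\infty$ (with $\inf\emptyset=\infty$); (b) $\int_S q(dy|x,a)w(y)\le\rho w(x)+b$ for all $x\in S$, $a\in A(x)$; (c) $\sup_{x\in S_l}\bar q_x<\infty$ for every $l$. **Condition 2** (for $\gamma$, $\alpha$, $M$, $c$). (a) $\int_S w\,d\gamma<\infty$; (b) $\alpha>\rho$; (c) $M\ge0$,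 $c\ge0$ and $|\inf_{a\in A(x)}c_0(x,a)|\le Mw(x)+c$ for all $x\in S$. **Theorem.** Suppose Condition 1 holds, and let $\pi$ be any policy. (a) For every initial distribution $\gamma$, $P^\pi_\gamma(T_\infty=\infty)=1$, and hence $P^\pi_\gamma(\xi_t\in S)=1$ for all $t\ge0$. Moreover, for all $x\in S$ and $t\ge0$, $$E^\pi_x[w(\xi_t)]\le e^{\rho t}w(x)+\frac b\rho\,(e^{\rho t}-1),$$ where for $\rho=0$ the right-hand side is read as its limit $w(x)+bt$. (b) If in addition Condition 2 holds for an initial distribution $\gamma$, a discount factor $\alpha$ and constants $M,c$, then $$V_0(\pi):=E^\pi_\gamma\Big[\int_0^\infty e^{-\alpha t}\int_A c_0(\xi_{t-},a)\,\pi(da|\omega,t)\,dt\Big]\ \ge\ -\frac{M\big(\alpha\int_S w\,d\gamma+b\big)}{\alpha(\alpha-\rho)}-\frac c\alpha\ >\ -\infty .$$ -/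

import Mathlib

open MeasureTheory ProbabilityTheory Filter Topology
open scoped ENNReal NNReal

noncomputable section

/-- The primitives of a controlled continuous-time jump model with state space `S` and action
space `A`. Only the values of `q` and `cost` at admissible pairs are constrained or used. -/
structure CTMDP (S A : Type*) [MeasurableSpace S] [MeasurableSpace A] where
  /-- the set `A(x)` of admissible actions at `x` -/
  adm : S → Set A
  /-- the set `K` of admissible pairs is measurable -/
  measurableSet_graph : MeasurableSet {p : S × A | p.2 ∈ adm p.1}
  /-- `K` contains the graph of a measurable map -/
  exists_selector : ∃ φ : S → A, Measurable φ ∧ ∀ x, φ x ∈ adm x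
  /-- the transition rate `q(dy | x, a)`, a signed kernel given `(x, a) ∈ K` -/
  q : S → A → SignedMeasure S
  measurable_q : ∀ Γ : Set S, MeasurableSet Γ →
    Measurable fun p : {p : S × A | p.2 ∈ adm p.1} => q p.1.1 p.1.2 Γ
  q_nonneg : ∀ x, ∀ a ∈ adm x, ∀ Γ : Set S, MeasurableSet Γ → x ∉ Γ → 0 ≤ q x a Γ
  /-- conservativeness -/
  q_univ : ∀ x, ∀ a ∈ adm x, q x a Set.univ = 0
  /-- stability: the total jump rates at `x` are bounded over `A(x)` -/
  q_stable : ∀ x, (⨆ a ∈ adm x, ENNReal.ofReal (-q x a {x})) < ⊤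
  /-- the cost rate `c₀` -/
  cost : S → A → ℝ
  measurable_cost : Measurable fun p : {p : S × A | p.2 ∈ adm p.1} => cost p.1.1 p.1.2

set_option linter.unusedSectionVars false

namespace CTMDP

variable {S A : Type*} [MeasurableSpace S] [MeasurableSpace A]

/-- The supremum over `A(x)` of the total jump rates `q_x(a) = -q({x} | x, a)`. -/
def maxRate (M : CTMDP S A) (x : S) : ℝ≥0∞ := ⨆ a ∈ M.adm x, ENNReal.ofReal (-M.q x a {x})

/-! ### Sample paths

An isolated point `Sum.inr ()` is adjoined to `S` and to `A`. -/

/-- The sequences `(θ₀, x₀), (θ₁, x₁), …` that make up the sample space, where `θ₀ = 0` is a dummy: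
`x₀ ∈ S`, the sojourn times `θ₁, θ₂, …` are positive, and as soon as one of them is infinite,
all later entries are `(∞, x_∞)`. -/
def IsPath (ω : ℕ → ℝ≥0∞ × (S ⊕ Unit)) : Prop :=
  (ω 0).1 = 0 ∧ (ω 0).2 ∈ Set.range Sum.inl ∧
    ∀ m, 0 < (ω (m + 1)).1 ∧ ((ω (m + 1)).1 = ⊤ ↔ (ω (m + 1)).2 = Sum.inr ()) ∧
      ((ω m).1 = ⊤ → (ω (m + 1)).1 = ⊤)

/-- The sample space, with the trace of the product σ-algebra. -/
abbrev Path (S : Type*) : Type _ := {ω : ℕ → ℝ≥0∞ × (S ⊕ Unit) // IsPath ω}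

/-- The sojourn time `θ_m`. -/
def sojourn (m : ℕ) (ω : Path S) : ℝ≥0∞ := (ω.1 m).1

/-- The post-jump state `x_m`. -/
def mark (m : ℕ) (ω : Path S) : S ⊕ Unit := (ω.1 m).2

/-- The jump moment `T_m = θ₁ + ⋯ + θ_m`. -/
def jumpTime (m : ℕ) (ω : Path S) : ℝ≥0∞ := ∑ i ∈ Finset.range (m + 1), sojourn i ω

/-- The explosion time `T_∞ = lim T_m`. -/
def explosionTime (ω : Path S) : ℝ≥0∞ := ⨆ m, jumpTime m ω

open Classical in
/-- The process `ξ_t`, equal to `x_m` for `T_m ≤ t < T_{m+1}` and to `x_∞` for `t ≥ T_∞`. -/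
def state (t : ℝ≥0) (ω : Path S) : S ⊕ Unit :=
  if h : ∃ m, jumpTime m ω ≤ t ∧ (t : ℝ≥0∞) < jumpTime (m + 1) ω then mark h.choose ω
  else Sum.inr ()

open Classical in
/-- The left limit `ξ_{t-}`, equal to `x_m` for `T_m < t ≤ T_{m+1}`, to `x₀` for `t = 0` and to
`x_∞` for `t ≥ T_∞`. -/
def leftState (t : ℝ≥0) (ω : Path S) : S ⊕ Unit :=
  if t = 0 then mark 0 ω
  else if h : ∃ m, jumpTime m ω < t ∧ (t : ℝ≥0∞) ≤ jumpTime (m + 1) ω then mark h.choose ω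
  else Sum.inr ()

/-- The history `ℱ_t` generated by the events `{T_m ≤ s, x_m ∈ Γ}` with `s ≤ t`. -/
abbrev history (S : Type*) [MeasurableSpace S] (t : ℝ≥0) : MeasurableSpace (Path S) :=
  MeasurableSpace.generateFrom {E | ∃ m : ℕ, ∃ s ≤ t, ∃ Γ : Set S, MeasurableSet Γ ∧
    E = {ω | jumpTime m ω ≤ (s : ℝ≥0∞) ∧ mark m ω ∈ Sum.inl '' Γ}}

/-- The σ-algebra `ℱ_{s-}` generated by all `ℱ_t` with `t < s`. -/
abbrev historyBefore (S : Type*) [MeasurableSpace S] (s : ℝ≥0) : MeasurableSpace (Path S) :=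
  ⨆ t : ℝ≥0, ⨆ _ : t < s, history S t

/-- The predictable σ-algebra on `Ω × [0, ∞)`. -/
abbrev predictable (S : Type*) [MeasurableSpace S] : MeasurableSpace (Path S × ℝ≥0) :=
  MeasurableSpace.generateFrom
    ({E | ∃ Γ : Set (Path S), MeasurableSet[history S 0] Γ ∧ E = Γ ×ˢ {0}} ∪
      {E | ∃ (s : ℝ≥0) (Γ : Set (Path S)), MeasurableSet[historyBefore S s] Γ ∧
        E = Γ ×ˢ Set.Ioi s})

/-- Admissible actions on the extended spaces, with `A(x_∞) = {a_∞}`. -/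
def extAdm (M : CTMDP S A) : S ⊕ Unit → Set (A ⊕ Unit)
  | Sum.inl x => Sum.inl '' M.adm x
  | Sum.inr _ => {Sum.inr ()}

/-- Randomized history-dependent policies: predictable transition probabilities `π(da | ω, t)`
that are concentrated on `A(ξ_{t-})`. -/
structure Policy (M : CTMDP S A) where
  toFun : Path S → ℝ≥0 → Measure (A ⊕ Unit)
  measurable_toFun :
    Measurable[predictable S] fun p : Path S × ℝ≥0 => toFun p.1 p.2
  isProbabilityMeasure : ∀ ω t, IsProbabilityMeasure (toFun ω t)
  concentrated : ∀ ω t, toFun ω t (M.extAdm (leftState t ω))ᶜ = 0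

/-- The path that follows `ω` up to and including its `k`-th jump and then stays put. -/
def freeze (k : ℕ) (ω : Path S) : Path S :=
  ⟨fun i => if i ≤ k then ω.1 i else (⊤, Sum.inr ()), by
    obtain ⟨h0, h1, h2⟩ := ω.2
    refine ⟨by simpa using h0, by simpa using h1, fun m => ?_⟩
    by_cases hm : m + 1 ≤ k
    · have hm' : m ≤ k := by omega
      simpa [hm, hm'] using h2 m
    · simp [hm]⟩

/-! ### Measurability of the path functionals -/

theorem measurableSet_isPath : MeasurableSet {ω : ℕ → ℝ≥0∞ × (S ⊕ Unit) | IsPath ω} := by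
  have h1 : ∀ m, Measurable fun ω : ℕ → ℝ≥0∞ × (S ⊕ Unit) => (ω m).1 := fun m => by fun_prop
  have h2 : ∀ m, Measurable fun ω : ℕ → ℝ≥0∞ × (S ⊕ Unit) => (ω m).2 := fun m => by fun_prop
  have htop : ∀ m, MeasurableSet {ω : ℕ → ℝ≥0∞ × (S ⊕ Unit) | (ω m).1 = ⊤} := fun m =>
    h1 m (measurableSet_singleton ⊤)
  have hinr : ∀ m, MeasurableSet {ω : ℕ → ℝ≥0∞ × (S ⊕ Unit) | (ω m).2 = Sum.inr ()} := fun m => by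
    have : MeasurableSet ({Sum.inr ()} : Set (S ⊕ Unit)) := by
      simpa using (measurableSet_inr_image (α := S)).2 (measurableSet_singleton ())
    exact h2 m this
  refine MeasurableSet.inter (h1 0 (measurableSet_singleton 0))
    (MeasurableSet.inter (h2 0 measurableSet_range_inl) ?_)
  have : {ω : ℕ → ℝ≥0∞ × (S ⊕ Unit) | ∀ m, 0 < (ω (m + 1)).1 ∧
      ((ω (m + 1)).1 = ⊤ ↔ (ω (m + 1)).2 = Sum.inr ()) ∧ ((ω m).1 = ⊤ → (ω (m + 1)).1 = ⊤)} =
      ⋂ m, {ω | 0 < (ω (m + 1)).1 ∧ ((ω (m + 1)).1 = ⊤ ↔ (ω (m + 1)).2 = Sum.inr ()) ∧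
        ((ω m).1 = ⊤ → (ω (m + 1)).1 = ⊤)} := by
    ext ω; simp
  change MeasurableSet {ω : ℕ → ℝ≥0∞ × (S ⊕ Unit) | ∀ m, 0 < (ω (m + 1)).1 ∧
      ((ω (m + 1)).1 = ⊤ ↔ (ω (m + 1)).2 = Sum.inr ()) ∧ ((ω m).1 = ⊤ → (ω (m + 1)).1 = ⊤)}
  rw [this]
  refine MeasurableSet.iInter fun m => ?_
  refine MeasurableSet.inter (h1 (m + 1) measurableSet_Ioi)
    (MeasurableSet.inter ((htop _).iff (hinr _)) ((htop _).imp (htop _)))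

theorem measurable_sojourn (m : ℕ) : Measurable (sojourn m : Path S → ℝ≥0∞) :=
  ((measurable_pi_apply m).comp measurable_subtype_coe).fst

theorem measurable_mark (m : ℕ) : Measurable (mark m : Path S → S ⊕ Unit) :=
  ((measurable_pi_apply m).comp measurable_subtype_coe).snd

theorem measurable_jumpTime (m : ℕ) : Measurable (jumpTime m : Path S → ℝ≥0∞) :=
  Finset.measurable_fun_sum _ fun i _ => measurable_sojourn i

theorem measurable_freeze (k : ℕ) : Measurable (freeze k : Path S → Path S) := by
  refine Measurable.subtype_mk (measurable_pi_lambda _ fun i => ?_)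
  by_cases hi : i ≤ k
  · simp only [hi, if_true]
    exact (measurable_pi_apply i).comp measurable_subtype_coe
  · simpa only [hi, if_false] using measurable_const

theorem history_le (t : ℝ≥0) : history S t ≤ (inferInstance : MeasurableSpace (Path S)) := by
  refine MeasurableSpace.generateFrom_le ?_
  rintro _ ⟨m, s, -, Γ, hΓ, rfl⟩
  exact MeasurableSet.inter (measurable_jumpTime m measurableSet_Iic)
    (measurable_mark m (measurableSet_inl_image.2 hΓ))

theorem predictable_le :
    predictable S ≤ (inferInstance : MeasurableSpace (Path S × ℝ≥0)) := by
  refine MeasurableSpace.generateFrom_le ?_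
  rintro _ (⟨Γ, hΓ, rfl⟩ | ⟨s, Γ, hΓ, rfl⟩)
  · exact (history_le 0 _ hΓ).prod (measurableSet_singleton 0)
  · refine MeasurableSet.prod ?_ measurableSet_Ioi
    exact (iSup₂_le fun t _ => history_le t : historyBefore S s ≤ _) _ hΓ

theorem Policy.measurable {M : CTMDP S A} (π : M.Policy) :
    Measurable fun p : Path S × ℝ≥0 => π.toFun p.1 p.2 :=
  π.measurable_toFun.mono predictable_le le_rfl

/-! ### Jump intensities -/

theorem integral_mul_exp_neg_integral (f : ℝ → ℝ) (C : ℝ) (hf : Measurable f) (h0 : ∀ u, 0 ≤ f u)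
    (hC : ∀ u, f u ≤ C) (t : ℝ) (ht : 0 ≤ t) :
    ∫ u in (0)..t, f u * Real.exp (-∫ v in (0)..u, f v) = 1 - Real.exp (-∫ v in (0)..t, f v) := by
  have hint : ∀ a b, IntervalIntegrable f volume a b := fun a b => by
    refine (intervalIntegrable_const (c := C)).mono_fun hf.aestronglyMeasurable ?_
    filter_upwards with u
    rw [Real.norm_of_nonneg (h0 u)]
    exact (hC u).trans (le_abs_self C)
  set F : ℝ → ℝ := fun u => ∫ v in (0)..u, f v with hF
  have hF0 : ∀ u, 0 ≤ u → 0 ≤ F u := fun u hu =>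
    intervalIntegral.integral_nonneg hu fun v _ => h0 v
  have hC0 : 0 ≤ C := (h0 0).trans (hC 0)
  have hexp : ∀ a b : ℝ, 0 ≤ a → 0 ≤ b → |Real.exp (-a) - Real.exp (-b)| ≤ |a - b| := by
    have key : ∀ a b : ℝ, 0 ≤ a → a ≤ b → Real.exp (-a) - Real.exp (-b) ≤ b - a := by
      intro a b ha hab
      have h1 : Real.exp (-b) = Real.exp (-a) * Real.exp (-(b - a)) := by
        rw [← Real.exp_add]; ring_nf
      have h2 : Real.exp (-a) ≤ 1 := Real.exp_le_one_iff.2 (by linarith)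
      have h3 := Real.add_one_le_exp (-(b - a))
      have h4 := Real.exp_pos (-a)
      rw [h1]
      nlinarith
    intro a b ha hb
    rcases le_total a b with h | h
    · rw [abs_of_nonneg (by simpa using h), abs_of_nonpos (by linarith)]
      linarith [key a b ha h]
    · rw [abs_of_nonpos (by simpa using h), abs_of_nonneg (by linarith)]
      linarith [key b a hb h]
  have hlip : LipschitzOnWith C.toNNReal (fun u => Real.exp (-F u)) (Set.uIcc 0 t) := by
    rw [Set.uIcc_of_le ht]
    refine LipschitzOnWith.of_dist_le_mul fun u hu v hv => ?_
    rw [Real.dist_eq, Real.dist_eq, Real.coe_toNNReal C hC0]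
    refine (hexp _ _ (hF0 u hu.1) (hF0 v hv.1)).trans ?_
    have : F u - F v = ∫ s in v..u, f s :=
      intervalIntegral.integral_interval_sub_left (hint _ _) (hint _ _)
    rw [this]
    refine intervalIntegral.norm_integral_le_of_norm_le_const (f := f) fun s _ => ?_
    rw [Real.norm_of_nonneg (h0 s)]
    exact hC s
  have hftc := hlip.absolutelyContinuousOnInterval.integral_deriv_eq_sub
  have hae := (hint 0 t).ae_hasDerivAt_integral
  have hcongr : ∫ u in (0)..t, deriv (fun u => Real.exp (-F u)) u =
      ∫ u in (0)..t, -(f u * Real.exp (-F u)) := by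
    refine intervalIntegral.integral_congr_ae ?_
    filter_upwards [hae] with u hu hmem
    have h1 : HasDerivAt F (f u) u := hu (Set.uIoc_subset_uIcc hmem) 0 Set.left_mem_uIcc
    have h2 : HasDerivAt (fun u => Real.exp (-F u)) (Real.exp (-F u) * -f u) u := h1.neg.exp
    rw [h2.deriv]
    ring
  rw [hcongr, intervalIntegral.integral_neg] at hftc
  have : F 0 = 0 := by simp [hF]
  rw [this] at hftc
  simp only [neg_zero, Real.exp_zero] at hftc
  linarith

theorem lintegral_exp_neg_add_exp_neg (g : ℝ → ℝ≥0∞) (hg : Measurable g) (C : ℝ≥0∞) (hC : C < ⊤)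
    (hle : ∀ u, g u ≤ C) :
    (∫⁻ u in Set.Ioi (0 : ℝ),
        EReal.exp (-((∫⁻ v in Set.Ioc 0 u, g v : ℝ≥0∞) : EReal)) * g u) +
      EReal.exp (-((∫⁻ v in Set.Ioi 0, g v : ℝ≥0∞) : EReal)) = 1 := by
  have hgt : ∀ u, g u ≠ ⊤ := fun u => ((hle u).trans_lt hC).ne
  let f : ℝ → ℝ := fun u => (g u).toReal
  have hf : Measurable f := hg.ennreal_toReal
  have hgf : ∀ u, g u = ENNReal.ofReal (f u) := fun u => (ENNReal.ofReal_toReal (hgt u)).symm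
  have h0 : ∀ u, 0 ≤ f u := fun u => ENNReal.toReal_nonneg
  have hfC : ∀ u, f u ≤ C.toReal := fun u => ENNReal.toReal_mono hC.ne (hle u)
  have hint : ∀ a b, IntervalIntegrable f volume a b := fun a b => by
    refine (intervalIntegrable_const (c := C.toReal)).mono_fun hf.aestronglyMeasurable ?_
    filter_upwards with u
    rw [Real.norm_of_nonneg (h0 u)]
    exact (hfC u).trans (le_abs_self _)
  have hG : ∀ u, 0 ≤ u → ∫⁻ v in Set.Ioc 0 u, g v = ENNReal.ofReal (∫ v in (0)..u, f v) := by
    intro u hu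
    rw [intervalIntegral.integral_of_le hu, ofReal_integral_eq_lintegral_ofReal (hint 0 u).1
      (ae_of_all _ h0)]
    simp_rw [hgf]
  have hE : ∀ u, 0 ≤ u → EReal.exp (-((∫⁻ v in Set.Ioc 0 u, g v : ℝ≥0∞) : EReal)) =
      ENNReal.ofReal (Real.exp (-∫ v in (0)..u, f v)) := by
    intro u hu
    rw [hG u hu, EReal.coe_ennreal_ofReal,
      max_eq_left (intervalIntegral.integral_nonneg hu fun v _ => h0 v), ← EReal.coe_neg,
      EReal.exp_coe]
  have hunion : Set.Ioi (0 : ℝ) = ⋃ n : ℕ, Set.Ioc (0 : ℝ) n := by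
    ext u
    simp only [Set.mem_Ioi, Set.mem_iUnion, Set.mem_Ioc]
    exact ⟨fun h => (exists_nat_ge u).imp fun n hn => ⟨h, hn⟩, fun ⟨n, h, _⟩ => h⟩
  have hmono : Monotone fun n : ℕ => Set.Ioc (0 : ℝ) n := fun m n h =>
    Set.Ioc_subset_Ioc_right (by exact_mod_cast h)
  have hlim : ∀ k : ℝ → ℝ≥0∞, Tendsto (fun n : ℕ => ∫⁻ u in Set.Ioc (0 : ℝ) n, k u) atTop
      (𝓝 (∫⁻ u in Set.Ioi (0 : ℝ), k u)) := by
    intro k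
    have h := tendsto_measure_iUnion_atTop (μ := volume.withDensity k) hmono
    rw [← hunion, withDensity_apply _ measurableSet_Ioi] at h
    refine h.congr fun n => ?_
    simp [withDensity_apply _ measurableSet_Ioc]
  have hcont : Continuous EReal.exp := EReal.expHomeomorph.continuous
  have h1 := (hlim fun u => EReal.exp (-((∫⁻ v in Set.Ioc 0 u, g v : ℝ≥0∞) : EReal)) * g u).add
    ((hcont.tendsto _).comp
      ((continuous_neg.tendsto _).comp ((continuous_coe_ennreal_ereal.tendsto _).comp (hlim g))))
  refine tendsto_nhds_unique h1 (tendsto_const_nhds.congr fun n => ?_)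
  have hn : (0 : ℝ) ≤ n := Nat.cast_nonneg n
  have hX : ∀ u, 0 ≤ u → 0 ≤ ∫ v in (0)..u, f v := fun u hu =>
    intervalIntegral.integral_nonneg hu fun v _ => h0 v
  have hcF : Continuous fun u => ∫ v in (0)..u, f v := intervalIntegral.continuous_primitive hint 0
  have hI : ∫⁻ u in Set.Ioc (0 : ℝ) n,
      EReal.exp (-((∫⁻ v in Set.Ioc 0 u, g v : ℝ≥0∞) : EReal)) * g u =
      ENNReal.ofReal (1 - Real.exp (-∫ v in (0)..(n : ℝ), f v)) := by
    rw [← integral_mul_exp_neg_integral f C.toReal hf h0 hfC n hn,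
      intervalIntegral.integral_of_le hn, ofReal_integral_eq_lintegral_ofReal]
    · refine setLIntegral_congr_fun measurableSet_Ioc fun u hu => ?_
      rw [hE u hu.1.le, hgf u, ← ENNReal.ofReal_mul (Real.exp_pos _).le, mul_comm]
    · exact ((hint 0 n).mul_continuousOn (by fun_prop)).1
    · exact ae_of_all _ fun u => mul_nonneg (h0 u) (Real.exp_pos _).le
  simp only [Function.comp_apply]
  rw [hI, hE n hn, ← ENNReal.ofReal_add _ (Real.exp_pos _).le]
  · simp
  · have := Real.exp_le_one_iff.2 (neg_nonpos.2 (hX n hn))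
    linarith

section Intensity

variable [StandardBorelSpace S]

theorem restrict_q_nonneg (M : CTMDP S A) {x : S} {a : A} (ha : a ∈ M.adm x) :
    0 ≤[({x} : Set S)ᶜ] M.q x a :=
  VectorMeasure.restrict_le_restrict_of_subset_le _ _ fun Γ hΓ hx => by
    simpa using M.q_nonneg x a ha Γ hΓ fun h => hx h rfl

open Classical in
/-- The measure `Γ ↦ q(Γ \ {x} | x, a)` for `(x, a) ∈ K`, extended by zero. -/
def jumpMeasure (M : CTMDP S A) : S ⊕ Unit → A ⊕ Unit → Measure S
  | Sum.inl x, Sum.inl a =>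
    if ha : a ∈ M.adm x then
      (M.q x a).toMeasureOfZeroLE {x}ᶜ (MeasurableSet.singleton x).compl (M.restrict_q_nonneg ha)
    else 0
  | _, _ => 0

theorem jumpMeasure_apply (M : CTMDP S A) {x : S} {a : A} (ha : a ∈ M.adm x) {Γ : Set S}
    (hΓ : MeasurableSet Γ) :
    M.jumpMeasure (Sum.inl x) (Sum.inl a) Γ = ENNReal.ofReal (M.q x a (Γ \ {x})) := by
  rw [jumpMeasure, dif_pos ha, SignedMeasure.toMeasureOfZeroLE_apply _ _ _ hΓ, Set.sdiff_eq,
    Set.inter_comm Γ]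
  exact (ENNReal.ofReal_eq_coe_nnreal _).symm

theorem jumpMeasure_univ_le (M : CTMDP S A) (x : S) (a : A ⊕ Unit) :
    M.jumpMeasure (Sum.inl x) a Set.univ ≤ M.maxRate x := by
  rcases a with a | a
  · by_cases ha : a ∈ M.adm x
    · rw [M.jumpMeasure_apply ha MeasurableSet.univ]
      have h : M.q x a (Set.univ \ {x}) = -M.q x a {x} := by
        have := VectorMeasure.of_add_of_sdiff (v := M.q x a) (MeasurableSet.singleton x)
          MeasurableSet.univ (Set.subset_univ _)
        rw [M.q_univ x a ha] at this
        linarith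
      rw [h]
      exact le_iSup₂ (f := fun a (_ : a ∈ M.adm x) => ENNReal.ofReal (-M.q x a {x})) a ha
    · simp [jumpMeasure, ha]
  · simp [jumpMeasure]

theorem measurable_q_section (M : CTMDP S A)
    {E : Set ({p : S × A | p.2 ∈ M.adm p.1} × S)} (hE : MeasurableSet E) :
    Measurable fun p : {p : S × A | p.2 ∈ M.adm p.1} => M.q p.1.1 p.1.2 (Prod.mk p ⁻¹' E) := by
  induction E, hE using MeasurableSpace.induction_on_inter generateFrom_prod.symm isPiSystem_prod with
  | empty => simp
  | basic E hE =>
    obtain ⟨s, hs, t, ht, rfl⟩ := hE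
    classical
    have : (fun p : {p : S × A | p.2 ∈ M.adm p.1} => M.q p.1.1 p.1.2 (Prod.mk p ⁻¹' s ×ˢ t)) =
        fun p => if p ∈ s then M.q p.1.1 p.1.2 t else 0 := by
      funext p
      by_cases hp : p ∈ s <;> simp [hp]
    rw [this]
    exact Measurable.ite hs (M.measurable_q t ht) measurable_const
  | compl E hE ih =>
    have : (fun p : {p : S × A | p.2 ∈ M.adm p.1} => M.q p.1.1 p.1.2 (Prod.mk p ⁻¹' Eᶜ)) =
        fun p => -M.q p.1.1 p.1.2 (Prod.mk p ⁻¹' E) := by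
      funext p
      have h := VectorMeasure.of_add_of_sdiff (v := M.q p.1.1 p.1.2) (measurable_prodMk_left hE)
        MeasurableSet.univ (Set.subset_univ (Prod.mk p ⁻¹' E))
      rw [M.q_univ _ _ p.2, ← Set.compl_eq_univ_sdiff] at h
      rw [Set.preimage_compl]
      linarith
    rw [this]
    exact ih.neg
  | iUnion f hd hf ih =>
    refine measurable_of_tendsto_metrizable
      (f := fun n p => ∑ i ∈ Finset.range n, M.q p.1.1 p.1.2 (Prod.mk p ⁻¹' f i))
      (fun n => Finset.measurable_fun_sum _ fun i _ => ih i) ?_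
    rw [tendsto_pi_nhds]
    intro p
    rw [Set.preimage_iUnion]
    exact ((M.q p.1.1 p.1.2).hasSum_of_disjoint_iUnion (fun i => measurable_prodMk_left (hf i))
      fun i j hij => (hd hij).preimage _).tendsto_sum_nat

theorem measurable_jumpMeasure (M : CTMDP S A) :
    Measurable fun p : (S ⊕ Unit) × (A ⊕ Unit) => M.jumpMeasure p.1 p.2 := by
  classical
  refine Measure.measurable_of_measurable_coe _ fun Γ hΓ => ?_
  let K : Set (S × A) := {p | p.2 ∈ M.adm p.1}
  have h1 : Measurable fun p : K => ENNReal.ofReal (M.q p.1.1 p.1.2 (Γ \ {p.1.1})) := by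
    have hE : MeasurableSet {z : K × S | z.2 ∈ Γ ∧ ¬z.2 = z.1.1.1} :=
      MeasurableSet.inter (measurable_snd hΓ)
        (measurableSet_eq_fun (f := fun z : K × S => z.2) (g := fun z : K × S => z.1.1.1)
          (by fun_prop) (by fun_prop)).compl
    exact (M.measurable_q_section hE).ennreal_ofReal
  have h2 : Measurable fun p : S × A => M.jumpMeasure (Sum.inl p.1) (Sum.inl p.2) Γ := by
    have := Measurable.dite (s := K) h1 (g := fun _ => (0 : ℝ≥0∞)) measurable_const
      M.measurableSet_graph
    convert this using 2 with p
    by_cases hp : p ∈ K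
    · rw [dif_pos hp, M.jumpMeasure_apply hp hΓ]
    · rw [dif_neg hp, jumpMeasure, dif_neg (show p.2 ∉ M.adm p.1 from hp)]
      simp
  have h3 : Measurable ((fun p : (S ⊕ Unit) × (A ⊕ Unit) => M.jumpMeasure p.1 p.2 Γ) ∘
      (MeasurableEquiv.sumProdSum S Unit A Unit).symm) :=
    measurable_fun_sum
      (measurable_fun_sum h2 (measurable_const (a := (0 : ℝ≥0∞))))
      (measurable_fun_sum (measurable_const (a := (0 : ℝ≥0∞)))
        (measurable_const (a := (0 : ℝ≥0∞))))
  have h4 := h3.comp (MeasurableEquiv.sumProdSum S Unit A Unit).measurable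
  rwa [Function.comp_assoc, MeasurableEquiv.symm_comp_self] at h4

theorem measurable_jumpMeasure_right (M : CTMDP S A) (x : S ⊕ Unit) :
    Measurable fun a => M.jumpMeasure x a :=
  M.measurable_jumpMeasure.comp measurable_prodMk_left

/-- The intensity `Λ^k(dy | h_k, u) = ∫ π(da | h_k, T_k + u) q(dy \ {x_k} | x_k, a)` at the time
`u` after the `k`-th jump. A predictable `π` depends, between the jumps `k` and `k + 1`, only on the
history `h_k` and the time, so it is evaluated at the path that makes no jump after the `k`-th. -/
def intensity {M : CTMDP S A} (π : M.Policy) (k : ℕ) (ω : Path S) (u : ℝ) : Measure S :=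
  (π.toFun (freeze k ω) ((jumpTime k ω).toNNReal + u.toNNReal)).bind
    fun a => M.jumpMeasure (mark k ω) a

/-- The tail `exp (-∫₀ᵘ Λ^k(S | h_k, v) dv)`. -/
def survival {M : CTMDP S A} (π : M.Policy) (k : ℕ) (ω : Path S) (u : ℝ) : ℝ≥0∞ :=
  EReal.exp (-((∫⁻ v in Set.Ioc 0 u, intensity π k ω v Set.univ : ℝ≥0∞) : EReal))

/-- The probability `exp (-∫₀^∞ Λ^k(S | h_k, v) dv)` that there is no jump after the `k`-th. -/
def noJump {M : CTMDP S A} (π : M.Policy) (k : ℕ) (ω : Path S) : ℝ≥0∞ :=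
  EReal.exp (-((∫⁻ v in Set.Ioi 0, intensity π k ω v Set.univ : ℝ≥0∞) : EReal))

open Classical in
/-- The conditional law of `(θ_{k+1}, x_{k+1})` given `h_k`: the point mass at `(∞, x_∞)` if
`θ_k = ∞`, and otherwise `Λ^k(dy | h_k, u) exp (-∫₀ᵘ Λ^k(S | h_k, v) dv) du` on `(0, ∞) × S` together
with the mass `exp (-∫₀^∞ Λ^k(S | h_k, v) dv)` at `(∞, x_∞)`. -/
def stepMeasure {M : CTMDP S A} (π : M.Policy) (k : ℕ) (ω : Path S) :
    Measure (ℝ≥0∞ × (S ⊕ Unit)) :=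
  if sojourn k ω = ⊤ then Measure.dirac (⊤, Sum.inr ())
  else
    (volume.restrict (Set.Ioi (0 : ℝ))).bind (fun u =>
        (survival π k ω u • intensity π k ω u).map fun y => (ENNReal.ofReal u, Sum.inl y)) +
      noJump π k ω • Measure.dirac (⊤, Sum.inr ())

theorem measurable_intensity {M : CTMDP S A} (π : M.Policy) (k : ℕ) :
    Measurable fun p : Path S × ℝ => intensity π k p.1 p.2 := by
  have hπ : Measurable fun p : Path S × ℝ =>
      π.toFun (freeze k p.1) ((jumpTime k p.1).toNNReal + p.2.toNNReal) :=
    π.measurable.comp (((measurable_freeze k).comp measurable_fst).prodMk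
      (((measurable_jumpTime k).comp measurable_fst).ennreal_toNNReal.add
        measurable_snd.real_toNNReal))
  let κ : Kernel (Path S × ℝ) (A ⊕ Unit) := ⟨_, hπ⟩
  have : IsMarkovKernel κ := ⟨fun p => π.isProbabilityMeasure _ _⟩
  have hJ : Measurable fun z : (Path S × ℝ) × (A ⊕ Unit) => M.jumpMeasure (mark k z.1.1) z.2 :=
    M.measurable_jumpMeasure.comp
      (((measurable_mark k).comp measurable_fst.fst).prodMk measurable_snd)
  refine Measure.measurable_of_measurable_coe _ fun Γ hΓ => ?_
  have h : ∀ p : Path S × ℝ, intensity π k p.1 p.2 Γ =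
      ∫⁻ a, M.jumpMeasure (mark k p.1) a Γ ∂κ p := fun p =>
    Measure.bind_apply hΓ (M.measurable_jumpMeasure_right _).aemeasurable
  simp_rw [h]
  exact Measurable.lintegral_kernel_prod_right
    (f := fun (p : Path S × ℝ) a => M.jumpMeasure (mark k p.1) a Γ) ((Measure.measurable_coe hΓ).comp hJ)

theorem intensity_univ_le {M : CTMDP S A} (π : M.Policy) (k : ℕ) (ω : Path S) {x : S}
    (hx : mark k ω = Sum.inl x) (u : ℝ) : intensity π k ω u Set.univ ≤ M.maxRate x := by
  have := π.isProbabilityMeasure (freeze k ω) ((jumpTime k ω).toNNReal + u.toNNReal)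
  rw [intensity, Measure.bind_apply MeasurableSet.univ
    (M.measurable_jumpMeasure_right _).aemeasurable, hx]
  exact (lintegral_mono fun a => M.jumpMeasure_univ_le x a).trans (by simp)

theorem isFiniteMeasure_intensity {M : CTMDP S A} (π : M.Policy) (k : ℕ) (ω : Path S) (u : ℝ) :
    IsFiniteMeasure (intensity π k ω u) := by
  rcases hx : mark k ω with x | x
  · exact ⟨(intensity_univ_le π k ω hx u).trans_lt (M.q_stable x)⟩
  · refine ⟨?_⟩
    rw [intensity, Measure.bind_apply MeasurableSet.univ
      (M.measurable_jumpMeasure_right _).aemeasurable, hx]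
    simp [jumpMeasure]

theorem measurable_intensity_univ {M : CTMDP S A} (π : M.Policy) (k : ℕ) :
    Measurable fun p : Path S × ℝ => intensity π k p.1 p.2 Set.univ :=
  (Measure.measurable_coe MeasurableSet.univ).comp (measurable_intensity π k)

theorem measurable_intensity_univ_right {M : CTMDP S A} (π : M.Policy) (k : ℕ) (ω : Path S) :
    Measurable fun u : ℝ => intensity π k ω u Set.univ :=
  Measurable.comp (g := fun p : Path S × ℝ => intensity π k p.1 p.2 Set.univ)
    (f := fun u : ℝ => (ω, u)) (measurable_intensity_univ π k) measurable_prodMk_left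

theorem measurable_exp_neg {α : Type*} [MeasurableSpace α] {f : α → ℝ≥0∞} (hf : Measurable f) :
    Measurable fun a => EReal.exp (-(f a : EReal)) :=
  EReal.exp_monotone.measurable.comp hf.coe_ereal_ennreal.neg

theorem measurable_survival {M : CTMDP S A} (π : M.Policy) (k : ℕ) :
    Measurable fun p : Path S × ℝ => survival π k p.1 p.2 := by
  refine measurable_exp_neg (f := fun p : Path S × ℝ =>
    ∫⁻ v in Set.Ioc 0 p.2, intensity π k p.1 v Set.univ) ?_
  let T : Set ((Path S × ℝ) × ℝ) := {z | 0 < z.2 ∧ z.2 ≤ z.1.2}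
  have hT : MeasurableSet T := (measurableSet_lt measurable_const measurable_snd).inter
    (measurableSet_le measurable_snd measurable_fst.snd)
  have hG : Measurable fun z : (Path S × ℝ) × ℝ => intensity π k z.1.1 z.2 Set.univ :=
    Measurable.comp (g := fun p : Path S × ℝ => intensity π k p.1 p.2 Set.univ)
      (f := fun z : (Path S × ℝ) × ℝ => (z.1.1, z.2)) (measurable_intensity_univ π k) (by fun_prop)
  have h := (hG.indicator hT).lintegral_prod_right' (ν := volume)
  have e : ∀ p : Path S × ℝ, ∫⁻ v in Set.Ioc 0 p.2, intensity π k p.1 v Set.univ =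
      ∫⁻ v, T.indicator (fun z => intensity π k z.1.1 z.2 Set.univ) (p, v) := fun p => by
    rw [← lintegral_indicator measurableSet_Ioc]
    refine lintegral_congr fun v => ?_
    by_cases hv : 0 < v ∧ v ≤ p.2
    · rw [Set.indicator_of_mem (s := Set.Ioc 0 p.2) hv, Set.indicator_of_mem (s := T) hv]
    · rw [Set.indicator_of_notMem (s := Set.Ioc 0 p.2) hv, Set.indicator_of_notMem (s := T) hv]
  simp_rw [e]
  exact h

theorem measurable_noJump {M : CTMDP S A} (π : M.Policy) (k : ℕ) :
    Measurable fun ω : Path S => noJump π k ω :=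
  measurable_exp_neg (measurable_intensity_univ π k).lintegral_prod_right'

theorem measurable_map_smul {α : Type*} [MeasurableSpace α] {κ : α × ℝ → Measure S}
    (hκ : Measurable κ) (hfin : ∀ p, IsFiniteMeasure (κ p)) {s : α × ℝ → ℝ≥0∞}
    (hs : Measurable s) :
    Measurable fun p : α × ℝ => (s p • κ p).map
      fun y => (ENNReal.ofReal p.2, (Sum.inl y : S ⊕ Unit)) := by
  refine Measure.measurable_of_measurable_coe _ fun D hD => ?_
  have hmk : ∀ u : ℝ, Measurable fun y : S => (ENNReal.ofReal u, (Sum.inl y : S ⊕ Unit)) :=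
    fun u => measurable_const.prodMk measurable_inl
  simp_rw [Measure.map_apply (hmk _) hD, Measure.smul_apply, smul_eq_mul]
  refine hs.mul ?_
  have hE : MeasurableSet ((fun z : (α × ℝ) × S =>
      (ENNReal.ofReal z.1.2, (Sum.inl z.2 : S ⊕ Unit))) ⁻¹' D) :=
    measurableSet_preimage (by fun_prop) hD
  exact Kernel.measurable_kernel_prodMk_left_of_finite (κ := ⟨κ, hκ⟩) hE hfin

theorem measurable_density {M : CTMDP S A} (π : M.Policy) (k : ℕ) :
    Measurable fun p : Path S × ℝ => (survival π k p.1 p.2 • intensity π k p.1 p.2).map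
      fun y => (ENNReal.ofReal p.2, (Sum.inl y : S ⊕ Unit)) :=
  measurable_map_smul (measurable_intensity π k)
    (fun p => isFiniteMeasure_intensity π k p.1 p.2) (measurable_survival π k)

theorem measurable_density_right {M : CTMDP S A} (π : M.Policy) (k : ℕ) (ω : Path S) :
    Measurable fun u : ℝ => (survival π k ω u • intensity π k ω u).map
      fun y => (ENNReal.ofReal u, (Sum.inl y : S ⊕ Unit)) :=
  (measurable_density π k).comp measurable_prodMk_left

theorem measurable_stepMeasure {M : CTMDP S A} (π : M.Policy) (k : ℕ) :
    Measurable (stepMeasure π k) := by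
  refine Measurable.ite (measurable_sojourn k (measurableSet_singleton ⊤)) measurable_const ?_
  refine Measure.measurable_of_measurable_coe _ fun D hD => ?_
  have h1 : ∀ ω : Path S, ((volume.restrict (Set.Ioi (0 : ℝ))).bind (fun u =>
      (survival π k ω u • intensity π k ω u).map fun y =>
        (ENNReal.ofReal u, (Sum.inl y : S ⊕ Unit)))) D = ∫⁻ u in Set.Ioi (0 : ℝ),
      ((survival π k ω u • intensity π k ω u).map fun y =>
        (ENNReal.ofReal u, (Sum.inl y : S ⊕ Unit))) D := fun ω =>
    Measure.bind_apply hD (measurable_density_right π k ω).aemeasurable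
  simp_rw [Measure.add_apply, h1, Measure.smul_apply, smul_eq_mul]
  exact ((Measure.measurable_coe hD).comp (measurable_density π k)).lintegral_prod_right'.add
    ((measurable_noJump π k).mul_const _)

theorem mark_eq_inl {k : ℕ} {ω : Path S} (h : sojourn k ω ≠ ⊤) : ∃ x, mark k ω = Sum.inl x := by
  rcases k with _ | k
  · obtain ⟨x, hx⟩ := ω.2.2.1
    exact ⟨x, hx.symm⟩
  · rcases hm : mark (k + 1) ω with x | x
    · exact ⟨x, rfl⟩
    · exact absurd ((ω.2.2.2 k).2.1.2 hm) h

theorem isProbabilityMeasure_stepMeasure {M : CTMDP S A} (π : M.Policy) (k : ℕ) (ω : Path S) :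
    IsProbabilityMeasure (stepMeasure π k ω) := by
  by_cases h : sojourn k ω = ⊤
  · rw [stepMeasure, if_pos h]
    infer_instance
  · obtain ⟨x, hx⟩ := mark_eq_inl h
    have hmk : ∀ u : ℝ, Measurable fun y : S => (ENNReal.ofReal u, (Sum.inl y : S ⊕ Unit)) :=
      fun u => measurable_const.prodMk measurable_inl
    refine ⟨?_⟩
    rw [stepMeasure, if_neg h, Measure.add_apply, Measure.bind_apply MeasurableSet.univ
      (measurable_density_right π k ω).aemeasurable]
    simp_rw [Measure.map_apply (hmk _) MeasurableSet.univ]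
    simp only [Set.preimage_univ, Measure.smul_apply, smul_eq_mul, measure_univ, mul_one]
    exact lintegral_exp_neg_add_exp_neg (fun u => intensity π k ω u Set.univ)
      (measurable_intensity_univ_right π k ω) (M.maxRate x) (M.q_stable x)
      fun u => intensity_univ_le π k ω hx u

end Intensity

/-! ### The law of the controlled process -/

/-- The sequence that extends a history `(θ₀, x₀), …, (θ_k, x_k)` by the entries `(∞, x_∞)`. -/
def extendHist (k : ℕ) (h : (i : Finset.Iic k) → ℝ≥0∞ × (S ⊕ Unit)) : ℕ → ℝ≥0∞ × (S ⊕ Unit) :=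
  fun i => if hi : i ≤ k then h ⟨i, Finset.mem_Iic.2 hi⟩ else (⊤, Sum.inr ())

theorem measurable_extendHist (k : ℕ) :
    Measurable (extendHist k : ((i : Finset.Iic k) → ℝ≥0∞ × (S ⊕ Unit)) → _) := by
  refine measurable_pi_lambda _ fun i => ?_
  by_cases hi : i ≤ k
  · simp only [extendHist, hi, dif_pos]
    exact measurable_pi_apply _
  · simp only [extendHist, hi]
    exact measurable_const

variable [StandardBorelSpace S]

open Classical in
/-- The transition kernel from the history `h_k` to `(θ_{k+1}, x_{k+1})`; histories that do not
belong to a sample path are irrelevant. -/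
def stepKernel {M : CTMDP S A} (π : M.Policy) (k : ℕ) :
    Kernel ((i : Finset.Iic k) → ℝ≥0∞ × (S ⊕ Unit)) (ℝ≥0∞ × (S ⊕ Unit)) where
  toFun h := if hp : IsPath (extendHist k h) then stepMeasure π k ⟨extendHist k h, hp⟩
    else Measure.dirac (⊤, Sum.inr ())
  measurable' := by
    refine Measurable.dite (s := {h | IsPath (extendHist k h)})
      (f := fun h => stepMeasure π k ⟨extendHist k h.1, h.2⟩)
      (g := fun _ => Measure.dirac (⊤, Sum.inr ())) ?_ measurable_const
      (measurable_extendHist k measurableSet_isPath)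
    exact (measurable_stepMeasure π k).comp
      (((measurable_extendHist k).comp measurable_subtype_coe).subtype_mk)

instance {M : CTMDP S A} (π : M.Policy) (k : ℕ) : IsMarkovKernel (stepKernel π k) := by
  refine ⟨fun h => ?_⟩
  by_cases hp : IsPath (extendHist k h)
  · simpa [stepKernel, hp] using isProbabilityMeasure_stepMeasure π k ⟨extendHist k h, hp⟩
  · simp only [stepKernel, Kernel.coe_mk, hp, dif_neg, not_false_eq_true]
    infer_instance

/-- The measure `P_γ^π`: the law of `(θ₀, x₀), (θ₁, x₁), …` on the sample space when `x₀` has the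
law `γ` and the conditional law of `(θ_{k+1}, x_{k+1})` given `h_k` is the step measure. -/
def law {M : CTMDP S A} (π : M.Policy) (γ : Measure S) : Measure (Path S) :=
  (Kernel.trajMeasure (X := fun _ => ℝ≥0∞ × (S ⊕ Unit))
    (γ.map fun x => ((0 : ℝ≥0∞), (Sum.inl x : S ⊕ Unit))) (stepKernel π)).comap Subtype.val

theorem ae_stepMeasure {M : CTMDP S A} (π : M.Policy) (k : ℕ) (ω : Path S) :
    ∀ᵐ e ∂stepMeasure π k ω, 0 < e.1 ∧ (e.1 = ⊤ ↔ e.2 = Sum.inr ()) ∧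
      (sojourn k ω = ⊤ → e.1 = ⊤) := by
  have hinr : MeasurableSet ({Sum.inr ()} : Set (S ⊕ Unit)) := by
    simpa using (measurableSet_inr_image (α := S)).2 (measurableSet_singleton ())
  have htop : MeasurableSet {e : ℝ≥0∞ × (S ⊕ Unit) | e.1 = ⊤} :=
    measurable_fst (measurableSet_singleton ⊤)
  have hD : MeasurableSet {e : ℝ≥0∞ × (S ⊕ Unit) | 0 < e.1 ∧ (e.1 = ⊤ ↔ e.2 = Sum.inr ()) ∧
      (sojourn k ω = ⊤ → e.1 = ⊤)} :=
    MeasurableSet.inter (measurable_fst measurableSet_Ioi)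
      (MeasurableSet.inter (htop.iff (measurable_snd hinr)) ((MeasurableSet.const _).imp htop))
  by_cases h : sojourn k ω = ⊤
  · rw [stepMeasure, if_pos h, ae_dirac_iff hD]
    simp
  · change stepMeasure π k ω {e | 0 < e.1 ∧ (e.1 = ⊤ ↔ e.2 = Sum.inr ()) ∧
      (sojourn k ω = ⊤ → e.1 = ⊤)}ᶜ = 0
    rw [stepMeasure, if_neg h, Measure.add_apply, Measure.bind_apply hD.compl
      (measurable_density_right π k ω).aemeasurable, Measure.smul_apply,
      Measure.dirac_apply' _ hD.compl]
    have h0 : ∀ u ∈ Set.Ioi (0 : ℝ), ((survival π k ω u • intensity π k ω u).map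
        fun y => (ENNReal.ofReal u, (Sum.inl y : S ⊕ Unit)))
        {e | 0 < e.1 ∧ (e.1 = ⊤ ↔ e.2 = Sum.inr ()) ∧ (sojourn k ω = ⊤ → e.1 = ⊤)}ᶜ = 0 := by
      intro u hu
      rw [Measure.map_apply (measurable_const.prodMk measurable_inl) hD.compl]
      refine measure_mono_null (t := ∅) (fun y hy => ?_) measure_empty
      simp [h, Set.mem_Ioi.1 hu] at hy
    rw [setLIntegral_congr_fun measurableSet_Ioi h0]
    simp [h]

theorem extendHist_frestrictLe (k : ℕ) (ω : Path S) :
    extendHist k (Preorder.frestrictLe k ω.1) = (freeze k ω).1 := by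
  funext i
  by_cases hi : i ≤ k <;> simp [extendHist, freeze, hi]

theorem freeze_freeze (k : ℕ) (ω : Path S) : freeze k (freeze k ω) = freeze k ω := by
  refine Subtype.ext (funext fun i => ?_)
  by_cases hi : i ≤ k <;> simp [freeze, hi]

theorem stepMeasure_freeze {M : CTMDP S A} (π : M.Policy) (k : ℕ) (ω : Path S) :
    stepMeasure π k (freeze k ω) = stepMeasure π k ω := by
  have h1 : ∀ i ≤ k, sojourn i (freeze k ω) = sojourn i ω := fun i hi => by
    simp [sojourn, freeze, hi]
  have h2 : mark k (freeze k ω) = mark k ω := by simp [mark, freeze]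
  have h3 : jumpTime k (freeze k ω) = jumpTime k ω :=
    Finset.sum_congr rfl fun i hi => h1 i (by simpa [Nat.lt_succ_iff] using hi)
  have h4 : intensity π k (freeze k ω) = intensity π k ω := by
    funext u
    rw [intensity, intensity, freeze_freeze, h2, h3]
  simp only [stepMeasure, survival, noJump, h1 k le_rfl, h4]

theorem stepKernel_frestrictLe {M : CTMDP S A} (π : M.Policy) (k : ℕ) (ω : Path S) :
    stepKernel π k (Preorder.frestrictLe k ω.1) = stepMeasure π k ω := by
  have hp : IsPath (extendHist k (Preorder.frestrictLe k ω.1)) :=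
    extendHist_frestrictLe k ω ▸ (freeze k ω).2
  have : (⟨_, hp⟩ : Path S) = freeze k ω := Subtype.ext (extendHist_frestrictLe k ω)
  rw [← stepMeasure_freeze, ← this]
  exact dif_pos hp

theorem isPath_of_forall {ω : ℕ → ℝ≥0∞ × (S ⊕ Unit)}
    (h0 : (ω 0).1 = 0 ∧ (ω 0).2 ∈ Set.range Sum.inl)
    (h : ∀ k, IsPath (extendHist k (Preorder.frestrictLe k ω)) →
      0 < (ω (k + 1)).1 ∧ ((ω (k + 1)).1 = ⊤ ↔ (ω (k + 1)).2 = Sum.inr ()) ∧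
        ((ω k).1 = ⊤ → (ω (k + 1)).1 = ⊤)) : IsPath ω := by
  have key : ∀ k, IsPath (extendHist k (Preorder.frestrictLe k ω)) := by
    intro k
    have hle : ∀ (j i : ℕ), i ≤ j → extendHist j (Preorder.frestrictLe j ω) i = ω i :=
      fun j i hi => by simp [extendHist, hi]
    have hgt : ∀ (j i : ℕ), ¬i ≤ j →
        extendHist j (Preorder.frestrictLe j ω) i = (⊤, Sum.inr ()) :=
      fun j i hi => by simp [extendHist, hi]
    induction k with
    | zero =>
      refine ⟨by rw [hle 0 0 le_rfl]; exact h0.1, by rw [hle 0 0 le_rfl]; exact h0.2, fun m => ?_⟩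
      rw [hgt 0 (m + 1) (by omega)]
      simp
    | succ k ih =>
      refine ⟨by rw [hle _ 0 (by omega)]; exact h0.1, by rw [hle _ 0 (by omega)]; exact h0.2,
        fun m => ?_⟩
      by_cases hm : m + 1 ≤ k
      · have := ih.2.2 m
        rw [hle k (m + 1) hm, hle k m (by omega)] at this
        rwa [hle _ (m + 1) (by omega), hle _ m (by omega)]
      · by_cases hm' : m = k
        · subst hm'
          rw [hle _ (m + 1) le_rfl, hle _ m (by omega)]
          exact h m ih
        · rw [hgt _ (m + 1) (by omega)]
          simp
  exact ⟨h0.1, h0.2, fun m => h m (key m)⟩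

theorem trajMeasure_map_zero {M : CTMDP S A} (π : M.Policy) (γ : Measure S)
    [IsProbabilityMeasure γ] :
    (Kernel.trajMeasure (X := fun _ => ℝ≥0∞ × (S ⊕ Unit))
      (γ.map fun x => ((0 : ℝ≥0∞), (Sum.inl x : S ⊕ Unit))) (stepKernel π)).map (fun ω => ω 0) =
      γ.map fun x => ((0 : ℝ≥0∞), (Sum.inl x : S ⊕ Unit)) := by
  have h : (fun ω : ℕ → ℝ≥0∞ × (S ⊕ Unit) => ω 0) =
      (fun h : (i : Finset.Iic 0) → ℝ≥0∞ × (S ⊕ Unit) => h ⟨0, by simp⟩) ∘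
        Preorder.frestrictLe (π := fun _ => ℝ≥0∞ × (S ⊕ Unit)) 0 := rfl
  rw [h, ← Measure.map_map (by fun_prop) (by fun_prop), Kernel.trajMeasure,
    Measure.map_comp _ _ (by fun_prop), Kernel.traj_map_frestrictLe, Kernel.partialTraj_self,
    Measure.id_comp, Measure.map_map (by fun_prop) (by fun_prop)]
  exact Measure.map_id

theorem ae_isPath {M : CTMDP S A} (π : M.Policy) (γ : Measure S) [IsProbabilityMeasure γ] :
    ∀ᵐ ω ∂Kernel.trajMeasure (X := fun _ => ℝ≥0∞ × (S ⊕ Unit))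
      (γ.map fun x => ((0 : ℝ≥0∞), (Sum.inl x : S ⊕ Unit))) (stepKernel π), IsPath ω := by
  have hm0 : Measurable fun x : S => ((0 : ℝ≥0∞), (Sum.inl x : S ⊕ Unit)) :=
    measurable_const.prodMk measurable_inl
  have : IsProbabilityMeasure (γ.map fun x => ((0 : ℝ≥0∞), (Sum.inl x : S ⊕ Unit))) :=
    Measure.isProbabilityMeasure_map hm0.aemeasurable
  set μ := Kernel.trajMeasure (X := fun _ => ℝ≥0∞ × (S ⊕ Unit))
      (γ.map fun x => ((0 : ℝ≥0∞), (Sum.inl x : S ⊕ Unit))) (stepKernel π) with hμ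
  have h0 : ∀ᵐ ω ∂μ, (ω 0).1 = 0 ∧ (ω 0).2 ∈ Set.range Sum.inl := by
    have hD : MeasurableSet {e : ℝ≥0∞ × (S ⊕ Unit) | e.1 = 0 ∧ e.2 ∈ Set.range Sum.inl} :=
      MeasurableSet.inter (measurable_fst (measurableSet_singleton 0))
        (measurable_snd measurableSet_range_inl)
    have h1 : ∀ᵐ e ∂μ.map (fun ω => ω 0), e.1 = 0 ∧ e.2 ∈ Set.range Sum.inl := by
      rw [hμ, trajMeasure_map_zero, ae_map_iff hm0.aemeasurable hD]
      exact ae_of_all _ fun x => ⟨rfl, x, rfl⟩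
    exact (ae_map_iff (measurable_pi_apply 0).aemeasurable hD).1 h1
  have hk : ∀ k, ∀ᵐ ω ∂μ, IsPath (extendHist k (Preorder.frestrictLe k ω)) →
      0 < (ω (k + 1)).1 ∧ ((ω (k + 1)).1 = ⊤ ↔ (ω (k + 1)).2 = Sum.inr ()) ∧
        ((ω k).1 = ⊤ → (ω (k + 1)).1 = ⊤) := by
    intro k
    let p : ((i : Finset.Iic k) → ℝ≥0∞ × (S ⊕ Unit)) × (ℝ≥0∞ × (S ⊕ Unit)) → Prop := fun z =>
      IsPath (extendHist k z.1) → 0 < z.2.1 ∧ (z.2.1 = ⊤ ↔ z.2.2 = Sum.inr ()) ∧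
        ((z.1 ⟨k, by simp⟩).1 = ⊤ → z.2.1 = ⊤)
    have hinr : MeasurableSet ({Sum.inr ()} : Set (S ⊕ Unit)) := by
      simpa using (measurableSet_inr_image (α := S)).2 (measurableSet_singleton ())
    have hp : MeasurableSet {z | p z} := by
      refine MeasurableSet.imp (p := fun z : ((i : Finset.Iic k) → ℝ≥0∞ × (S ⊕ Unit)) ×
        (ℝ≥0∞ × (S ⊕ Unit)) => IsPath (extendHist k z.1))
        (measurableSet_preimage ((measurable_extendHist k).comp measurable_fst)
          measurableSet_isPath) ?_
      have htop : MeasurableSet {z : ((i : Finset.Iic k) → ℝ≥0∞ × (S ⊕ Unit)) ×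
          (ℝ≥0∞ × (S ⊕ Unit)) | z.2.1 = ⊤} :=
        measurable_snd.fst (measurableSet_singleton ⊤)
      refine MeasurableSet.inter (measurable_snd.fst measurableSet_Ioi) (MeasurableSet.inter
        (htop.iff (measurable_snd.snd hinr)) (MeasurableSet.imp ?_ htop))
      exact ((measurable_pi_apply _).comp measurable_fst).fst (measurableSet_singleton ⊤)
    have h1 : ∀ᵐ z ∂(μ.map (Preorder.frestrictLe k)) ⊗ₘ (stepKernel π k), p z := by
      refine Measure.ae_compProd_of_ae_ae hp (ae_of_all _ fun h => ?_)
      by_cases hh : IsPath (extendHist k h)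
      · have e : stepKernel π k h = stepMeasure π k ⟨_, hh⟩ := dif_pos hh
        rw [e]
        filter_upwards [ae_stepMeasure π k ⟨_, hh⟩] with z hz _
        simpa [sojourn, extendHist] using hz
      · exact ae_of_all _ fun z h' => absurd h' hh
    rw [hμ, Kernel.map_frestrictLe_trajMeasure_compProd_eq_map_trajMeasure, ae_map_iff] at h1
    · exact h1
    · exact Measurable.aemeasurable (by fun_prop)
    · exact hp
  filter_upwards [h0, ae_all_iff.2 hk] with ω hω0 hω
  exact isPath_of_forall hω0 hω

theorem law_map_val {M : CTMDP S A} (π : M.Policy) (γ : Measure S) [IsProbabilityMeasure γ] :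
    (law π γ).map Subtype.val = Kernel.trajMeasure (X := fun _ => ℝ≥0∞ × (S ⊕ Unit))
      (γ.map fun x => ((0 : ℝ≥0∞), (Sum.inl x : S ⊕ Unit))) (stepKernel π) := by
  refine ((MeasurableEmbedding.subtype_coe measurableSet_isPath).map_comap _).trans ?_
  rw [Subtype.range_coe]
  exact Measure.restrict_eq_self_of_ae_mem (ae_isPath π γ)

instance {M : CTMDP S A} (π : M.Policy) (γ : Measure S) [IsProbabilityMeasure γ] :
    IsProbabilityMeasure (law π γ) := by
  have : IsProbabilityMeasure (γ.map fun x => ((0 : ℝ≥0∞), (Sum.inl x : S ⊕ Unit))) :=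
    Measure.isProbabilityMeasure_map (measurable_const.prodMk measurable_inl).aemeasurable
  refine ⟨?_⟩
  rw [← Set.preimage_univ (f := Subtype.val),
    ← Measure.map_apply measurable_subtype_coe MeasurableSet.univ, law_map_val]
  exact measure_univ

/-- Under `P_γ^π` the initial state has the law `γ`. -/
theorem law_map_mark_zero {M : CTMDP S A} (π : M.Policy) (γ : Measure S)
    [IsProbabilityMeasure γ] : (law π γ).map (mark 0) = γ.map Sum.inl := by
  have h : (mark 0 : Path S → S ⊕ Unit) =
      Prod.snd ∘ (fun ω : ℕ → ℝ≥0∞ × (S ⊕ Unit) => ω 0) ∘ Subtype.val := rfl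
  rw [h, ← Measure.map_map measurable_snd ((measurable_pi_apply 0).comp measurable_subtype_coe),
    ← Measure.map_map (measurable_pi_apply 0) measurable_subtype_coe, law_map_val,
    trajMeasure_map_zero, Measure.map_map measurable_snd (measurable_const.prodMk measurable_inl)]
  rfl

/-- Under `P_γ^π` the conditional law of `(θ_{k+1}, x_{k+1})` given `h_k` is the step measure. -/
theorem law_step {M : CTMDP S A} (π : M.Policy) (γ : Measure S) [IsProbabilityMeasure γ] (k : ℕ)
    {B : Set (Path S)} (hB : MeasurableSet B) {D : Set (ℝ≥0∞ × (S ⊕ Unit))}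
    (hD : MeasurableSet D) :
    law π γ {ω | freeze k ω ∈ B ∧ ω.1 (k + 1) ∈ D} =
      ∫⁻ ω in freeze k ⁻¹' B, stepMeasure π k ω D ∂law π γ := by
  have : IsProbabilityMeasure (γ.map fun x => ((0 : ℝ≥0∞), (Sum.inl x : S ⊕ Unit))) :=
    Measure.isProbabilityMeasure_map (measurable_const.prodMk measurable_inl).aemeasurable
  let f : (ℕ → ℝ≥0∞ × (S ⊕ Unit)) → ((i : Finset.Iic k) → ℝ≥0∞ × (S ⊕ Unit)) :=
    Preorder.frestrictLe k
  have hf : Measurable f := by fun_prop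
  let B' : Set ((i : Finset.Iic k) → ℝ≥0∞ × (S ⊕ Unit)) := extendHist k ⁻¹' (Subtype.val '' B)
  have hB' : MeasurableSet B' := measurable_extendHist k
    ((MeasurableEmbedding.subtype_coe measurableSet_isPath).measurableSet_image.2 hB)
  have hmem : ∀ ω : Path S, f ω.1 ∈ B' ↔ freeze k ω ∈ B := fun ω => by
    change extendHist k (Preorder.frestrictLe k ω.1) ∈ Subtype.val '' B ↔ _
    rw [extendHist_frestrictLe]
    exact Subtype.val_injective.mem_set_image
  have h1 : {ω : Path S | freeze k ω ∈ B ∧ ω.1 (k + 1) ∈ D} =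
      Subtype.val ⁻¹' ((fun x : ℕ → ℝ≥0∞ × (S ⊕ Unit) => (f x, x (k + 1))) ⁻¹' (B' ×ˢ D)) := by
    ext ω
    exact and_congr_left' (hmem ω).symm
  have h2 : freeze k ⁻¹' B = Subtype.val ⁻¹' (f ⁻¹' B') := by
    ext ω
    exact (hmem ω).symm
  have hpair : Measurable fun x : ℕ → ℝ≥0∞ × (S ⊕ Unit) => (f x, x (k + 1)) := by fun_prop
  have hκ : Measurable fun h => stepKernel π k h D := (stepKernel π k).measurable_coe hD
  simp_rw [← stepKernel_frestrictLe]
  rw [h1, ← Measure.map_apply measurable_subtype_coe (hpair (hB'.prod hD)), h2,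
    ← setLIntegral_map (f := fun x => stepKernel π k (f x) D) (hf hB') (hκ.comp hf)
      measurable_subtype_coe, law_map_val, ← Measure.map_apply hpair (hB'.prod hD),
    ← setLIntegral_map (f := fun h => stepKernel π k h D) hB' hκ hf,
    ← Measure.compProd_apply_prod hB' hD,
    Kernel.map_frestrictLe_trajMeasure_compProd_eq_map_trajMeasure]

/-! ### Conditions and the performance functional -/

/-- The Lyapunov-type condition. -/
structure LyapunovCondition (M : CTMDP S A) (w : S → ℝ) (ρ b : ℝ) (Sl : ℕ → Set S) : Prop where
  measurable_w : Measurable w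
  one_le_w : ∀ x, 1 ≤ w x
  rho_nonneg : 0 ≤ ρ
  b_nonneg : 0 ≤ b
  measurableSet_Sl : ∀ l, MeasurableSet (Sl l)
  monotone_Sl : Monotone Sl
  iUnion_Sl : ⋃ l, Sl l = Set.univ
  tendsto_iInf : Tendsto (fun l => ⨅ x ∈ (Sl l)ᶜ, (w x : EReal)) atTop (𝓝 ⊤)
  /-- `∫ w dq(· | x, a)` exists and is at most `ρ w(x) + b` -/
  drift : ∀ x, ∀ a ∈ M.adm x, Integrable w (M.q x a).totalVariation ∧
    ∫ y, w y ∂(M.q x a).toJordanDecomposition.posPart -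
      ∫ y, w y ∂(M.q x a).toJordanDecomposition.negPart ≤ ρ * w x + b
  rates_bounded : ∀ l, (⨆ x ∈ Sl l, M.maxRate x) < ⊤

/-- The condition under which the performance functional is bounded from below. -/
structure CostCondition (M : CTMDP S A) (w : S → ℝ) (ρ α : ℝ) (γ : Measure S) (C c : ℝ) :
    Prop where
  integrable_w : Integrable w γ
  rho_lt : ρ < α
  C_nonneg : 0 ≤ C
  c_nonneg : 0 ≤ c
  abs_iInf_cost_le : ∀ x, (⨅ a ∈ M.adm x, (M.cost x a : EReal)).abs ≤
    ENNReal.ofReal (C * w x + c)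

/-- The integral `∫ f⁺ - ∫ f⁻` of an extended real function, with the convention `∞ - ∞ = -∞`. -/
def eintegral {X : Type*} [MeasurableSpace X] (μ : Measure X) (f : X → EReal) : EReal :=
  ((∫⁻ x, (f x).toENNReal ∂μ : ℝ≥0∞) : EReal) - ((∫⁻ x, (-f x).toENNReal ∂μ : ℝ≥0∞) : EReal)

/-- The expected cost rate `∫_A c₀(ξ_{t-}, a) π(da | ω, t)`; it is zero at `x_∞`. -/
def costRate {M : CTMDP S A} (π : M.Policy) (ω : Path S) (t : ℝ≥0) : EReal :=
  match leftState t ω with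
  | Sum.inl x => eintegral ((π.toFun ω t).comap Sum.inl) fun a => (M.cost x a : EReal)
  | Sum.inr _ => 0

/-- The expected total `α`-discounted cost `V₀(π)` under the initial distribution `γ`. -/
def discountedCost {M : CTMDP S A} (π : M.Policy) (γ : Measure S) (α : ℝ) : EReal :=
  eintegral (law π γ) fun ω =>
    eintegral (volume.restrict (Set.Ioi (0 : ℝ))) fun t =>
      (Real.exp (-α * t) : EReal) * costRate π ω t.toNNReal

end CTMDP

end

namespace CTMDP

/-! ### Integration by parts against an exponential survival function -/

theorem integral_exp_neg_integral_mul {f : ℝ → ℝ} {C : ℝ} (hf : Measurable f) (h0 : ∀ u, 0 ≤ f u)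
    (hC : ∀ u, f u ≤ C) {g d : ℝ → ℝ} (hg : ∀ u, HasDerivAt g (-d u) u) (hd : Continuous d)
    {s : ℝ} (hs : 0 ≤ s) :
    ∫ u in (0)..s, Real.exp (-∫ v in (0)..u, f v) * (f u * g u + d u) =
      g 0 - Real.exp (-∫ v in (0)..s, f v) * g s := by
  have hint : ∀ a b, IntervalIntegrable f volume a b := fun a b => by
    refine (intervalIntegrable_const (c := C)).mono_fun hf.aestronglyMeasurable ?_
    filter_upwards with u
    rw [Real.norm_of_nonneg (h0 u)]
    exact (hC u).trans (le_abs_self C)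
  have hcF : Continuous fun u => ∫ v in (0)..u, f v := intervalIntegral.continuous_primitive hint 0
  set h : ℝ → ℝ := fun u => f u * Real.exp (-∫ v in (0)..u, f v) with hh
  have hhint : IntervalIntegrable h volume 0 s := (hint 0 s).mul_continuousOn (by fun_prop)
  set E : ℝ → ℝ := fun u => 1 - ∫ v in (0)..u, h v with hE
  have hEe : ∀ u, 0 ≤ u → E u = Real.exp (-∫ v in (0)..u, f v) := fun u hu => by
    simp only [hE, hh]
    rw [integral_mul_exp_neg_integral f C hf h0 hC u hu]
    ring
  have hEac : AbsolutelyContinuousOnInterval E 0 s :=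
    (contDiff_const (n := 1)).contDiffOn.absolutelyContinuousOnInterval.sub
      (hhint.absolutelyContinuousOnInterval_intervalIntegral Set.left_mem_uIcc)
  have hgd : deriv g = fun u => -d u := funext fun u => (hg u).deriv
  have hgac : AbsolutelyContinuousOnInterval g 0 s := by
    refine ContDiffOn.absolutelyContinuousOnInterval (ContDiff.contDiffOn ?_)
    rw [contDiff_one_iff_deriv]
    exact ⟨fun u => (hg u).differentiableAt, hgd ▸ hd.neg⟩
  have key := hEac.integral_deriv_mul_eq_sub hgac
  rw [hEe s hs, hEe 0 le_rfl, intervalIntegral.integral_same, neg_zero, Real.exp_zero,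
    one_mul] at key
  rw [← neg_sub, ← key, ← intervalIntegral.integral_neg]
  refine intervalIntegral.integral_congr_ae ?_
  filter_upwards [hhint.ae_hasDerivAt_integral] with u hu hmem
  have h1 : HasDerivAt E (-h u) u := by
    simpa using (hu (Set.uIoc_subset_uIcc hmem) 0 Set.left_mem_uIcc).const_sub 1
  rw [h1.deriv, hgd, hEe u (by rw [Set.uIoc_of_le hs] at hmem; exact hmem.1.le), hh]
  ring

theorem exp_neg_mul_add_lintegral {l : ℝ → ℝ≥0∞} (hl : Measurable l) {C : ℝ≥0∞} (hC : C < ⊤)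
    (hle : ∀ u, l u ≤ C) {g d : ℝ → ℝ} (hg : ∀ u, HasDerivAt g (-d u) u) (hd : Continuous d)
    {s : ℝ} (hs : 0 ≤ s) (hg0 : ∀ u ≤ s, 0 ≤ g u) (hd0 : ∀ u, 0 ≤ d u) :
    EReal.exp (-((∫⁻ v in Set.Ioc 0 s, l v : ℝ≥0∞) : EReal)) * ENNReal.ofReal (g s) +
      ∫⁻ u in Set.Ioc 0 s, EReal.exp (-((∫⁻ v in Set.Ioc 0 u, l v : ℝ≥0∞) : EReal)) *
        (l u * ENNReal.ofReal (g u) + ENNReal.ofReal (d u)) = ENNReal.ofReal (g 0) := by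
  let f : ℝ → ℝ := fun u => (l u).toReal
  have hf : Measurable f := hl.ennreal_toReal
  have hlf : ∀ u, l u = ENNReal.ofReal (f u) := fun u =>
    (ENNReal.ofReal_toReal ((hle u).trans_lt hC).ne).symm
  have h0 : ∀ u, 0 ≤ f u := fun u => ENNReal.toReal_nonneg
  have hfC : ∀ u, f u ≤ C.toReal := fun u => ENNReal.toReal_mono hC.ne (hle u)
  have hint : ∀ a b, IntervalIntegrable f volume a b := fun a b => by
    refine (intervalIntegrable_const (c := C.toReal)).mono_fun hf.aestronglyMeasurable ?_
    filter_upwards with u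
    rw [Real.norm_of_nonneg (h0 u)]
    exact (hfC u).trans (le_abs_self _)
  have hE : ∀ u, 0 ≤ u → EReal.exp (-((∫⁻ v in Set.Ioc 0 u, l v : ℝ≥0∞) : EReal)) =
      ENNReal.ofReal (Real.exp (-∫ v in (0)..u, f v)) := by
    intro u hu
    have : ∫⁻ v in Set.Ioc 0 u, l v = ENNReal.ofReal (∫ v in (0)..u, f v) := by
      rw [intervalIntegral.integral_of_le hu, ofReal_integral_eq_lintegral_ofReal (hint 0 u).1
        (ae_of_all _ h0)]
      simp_rw [hlf]
    rw [this, EReal.coe_ennreal_ofReal,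
      max_eq_left (intervalIntegral.integral_nonneg hu fun v _ => h0 v), ← EReal.coe_neg,
      EReal.exp_coe]
  have hcF : Continuous fun u => ∫ v in (0)..u, f v := intervalIntegral.continuous_primitive hint 0
  have hcg : Continuous g := continuous_iff_continuousAt.2 fun u => (hg u).continuousAt
  have hI : ∫⁻ u in Set.Ioc 0 s, EReal.exp (-((∫⁻ v in Set.Ioc 0 u, l v : ℝ≥0∞) : EReal)) *
        (l u * ENNReal.ofReal (g u) + ENNReal.ofReal (d u)) =
      ENNReal.ofReal (g 0 - Real.exp (-∫ v in (0)..s, f v) * g s) := by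
    rw [← integral_exp_neg_integral_mul hf h0 hfC hg hd hs, intervalIntegral.integral_of_le hs,
      ofReal_integral_eq_lintegral_ofReal]
    · refine setLIntegral_congr_fun measurableSet_Ioc fun u hu => ?_
      rw [hE u hu.1.le, hlf u, ← ENNReal.ofReal_mul (h0 u),
        ← ENNReal.ofReal_add (mul_nonneg (h0 u) (hg0 u hu.2)) (hd0 u),
        ← ENNReal.ofReal_mul (Real.exp_pos _).le]
    · exact ((((hint 0 s).mul_continuousOn hcg.continuousOn).add
        (hd.intervalIntegrable 0 s)).continuousOn_mul (by fun_prop)).1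
    · refine (ae_restrict_iff' measurableSet_Ioc).2 (ae_of_all _ fun u hu => ?_)
      exact mul_nonneg (Real.exp_pos _).le (add_nonneg (mul_nonneg (h0 u) (hg0 u hu.2)) (hd0 u))
  have hnn : 0 ≤ g 0 - Real.exp (-∫ v in (0)..s, f v) * g s := by
    rw [← integral_exp_neg_integral_mul hf h0 hfC hg hd hs]
    exact intervalIntegral.integral_nonneg hs fun u hu =>
      mul_nonneg (Real.exp_pos _).le (add_nonneg (mul_nonneg (h0 u) (hg0 u hu.2)) (hd0 u))
  rw [hI, hE s hs, ← ENNReal.ofReal_mul (Real.exp_pos _).le,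
    ← ENNReal.ofReal_add (mul_nonneg (Real.exp_pos _).le (hg0 s le_rfl)) hnn]
  congr 1
  ring

/-! ### The growth bound -/

/-- The solution `r ↦ e^{ρ r} v + (b / ρ) (e^{ρ r} - 1)` of the linear growth equation
with rate `ρ`, inflow `b` and initial value `v`. -/
noncomputable def growthBound (ρ b r v : ℝ) : ℝ :=
  Real.exp (ρ * r) * v + if ρ = 0 then b * r else b / ρ * (Real.exp (ρ * r) - 1)

theorem hasDerivAt_growthBound (ρ b r v : ℝ) :
    HasDerivAt (fun r => growthBound ρ b r v) (Real.exp (ρ * r) * (ρ * v + b)) r := by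
  have he : HasDerivAt (fun r => Real.exp (ρ * r)) (Real.exp (ρ * r) * ρ) r := by
    simpa using ((hasDerivAt_id r).const_mul ρ).exp
  by_cases hρ : ρ = 0
  · simp only [growthBound, hρ, if_true]
    simpa using ((hasDerivAt_id r).const_mul b).const_add v
  · simp only [growthBound, hρ, if_false]
    refine ((he.mul_const v).add ((he.sub_const 1).const_mul (b / ρ))).congr_deriv ?_
    field_simp

theorem growthBound_zero (ρ b v : ℝ) : growthBound ρ b 0 v = v := by simp [growthBound]

theorem growthBound_eq (ρ b r v : ℝ) :
    growthBound ρ b r v = Real.exp (ρ * r) * v + growthBound ρ b r 0 := by simp [growthBound]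

theorem growthBound_zero_nonneg {ρ b r : ℝ} (hρ : 0 ≤ ρ) (hb : 0 ≤ b) (hr : 0 ≤ r) :
    0 ≤ growthBound ρ b r 0 := by
  rw [growthBound]
  have := Real.one_le_exp (mul_nonneg hρ hr)
  split_ifs
  · positivity
  · have : 0 ≤ Real.exp (ρ * r) - 1 := by linarith
    positivity

theorem le_growthBound {ρ b r v : ℝ} (hρ : 0 ≤ ρ) (hb : 0 ≤ b) (hr : 0 ≤ r) (hv : 0 ≤ v) :
    v ≤ growthBound ρ b r v := by
  rw [growthBound_eq]
  have := Real.one_le_exp (mul_nonneg hρ hr)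
  have := growthBound_zero_nonneg hρ hb hr
  nlinarith

theorem continuous_growthBound (ρ b : ℝ) :
    Continuous fun p : ℝ × ℝ => growthBound ρ b p.1 p.2 := by
  by_cases hρ : ρ = 0 <;> simp only [growthBound, hρ, if_true, if_false] <;> fun_prop

theorem lintegral_exp_mul_growthBound_le {ρ b α v : ℝ} (hρ : 0 ≤ ρ) (hb : 0 ≤ b) (hα : ρ < α)
    (hv : 0 ≤ v) :
    ∫⁻ t in Set.Ioi (0 : ℝ), ENNReal.ofReal (Real.exp (-α * t)) *
      ENNReal.ofReal (growthBound ρ b t v) ≤ ENNReal.ofReal ((α * v + b) / (α * (α - ρ))) := by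
  have hα0 : 0 < α := hρ.trans_lt hα
  have hαρ : 0 < α - ρ := sub_pos.2 hα
  let P : ℝ → ℝ := fun t => -(Real.exp (-α * t) * growthBound ρ b t v +
    Real.exp (-(α - ρ) * t) * ((ρ * v + b) / (α - ρ))) / α
  have hP : ∀ t, HasDerivAt P (Real.exp (-α * t) * growthBound ρ b t v) t := fun t => by
    have h1 : HasDerivAt (fun t => Real.exp (-α * t)) (Real.exp (-α * t) * -α) t := by
      simpa using ((hasDerivAt_id t).const_mul (-α)).exp
    have h2 : HasDerivAt (fun t => Real.exp (-(α - ρ) * t))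
        (Real.exp (-(α - ρ) * t) * -(α - ρ)) t := by
      simpa using ((hasDerivAt_id t).const_mul (-(α - ρ))).exp
    refine ((((h1.mul (hasDerivAt_growthBound ρ b t v)).add
      (h2.mul_const ((ρ * v + b) / (α - ρ)))).neg.div_const α)).congr_deriv ?_
    have : Real.exp (-(α - ρ) * t) = Real.exp (-α * t) * Real.exp (ρ * t) := by
      rw [← Real.exp_add]; ring_nf
    rw [this]
    field_simp
    ring
  have hc : Continuous fun t => Real.exp (-α * t) * growthBound ρ b t v := by
    have := (continuous_growthBound ρ b).comp (continuous_id.prodMk (continuous_const (y := v)))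
    exact (by fun_prop : Continuous fun t => Real.exp (-α * t)).mul this
  have hg : ∀ t, 0 ≤ t → 0 ≤ growthBound ρ b t v := fun t ht =>
    hv.trans (le_growthBound hρ hb ht hv)
  have hunion : Set.Ioi (0 : ℝ) = ⋃ n : ℕ, Set.Ioc (0 : ℝ) n := by
    ext u
    simp only [Set.mem_Ioi, Set.mem_iUnion, Set.mem_Ioc]
    exact ⟨fun h => (exists_nat_ge u).imp fun n hn => ⟨h, hn⟩, fun ⟨n, h, _⟩ => h⟩
  have hmono : Monotone fun n : ℕ => Set.Ioc (0 : ℝ) n := fun m n h =>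
    Set.Ioc_subset_Ioc_right (by exact_mod_cast h)
  rw [hunion, setLIntegral_iUnion_of_directed _ hmono.directed_le]
  refine iSup_le fun n => ?_
  have hn : (0 : ℝ) ≤ n := Nat.cast_nonneg n
  have hftc := intervalIntegral.integral_eq_sub_of_hasDerivAt (fun t _ => hP t)
    (hc.intervalIntegrable 0 n)
  calc ∫⁻ t in Set.Ioc (0 : ℝ) n, ENNReal.ofReal (Real.exp (-α * t)) *
        ENNReal.ofReal (growthBound ρ b t v)
      = ENNReal.ofReal (∫ t in (0)..(n : ℝ), Real.exp (-α * t) * growthBound ρ b t v) := by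
        rw [intervalIntegral.integral_of_le hn, ofReal_integral_eq_lintegral_ofReal
          (hc.intervalIntegrable 0 n).1]
        · exact setLIntegral_congr_fun measurableSet_Ioc fun t _ =>
            (ENNReal.ofReal_mul (Real.exp_pos _).le).symm
        · exact (ae_restrict_iff' measurableSet_Ioc).2 (ae_of_all _ fun t ht =>
            mul_nonneg (Real.exp_pos _).le (hg t ht.1.le))
    _ ≤ _ := by
        refine ENNReal.ofReal_le_ofReal ?_
        rw [hftc]
        have h1 : P n ≤ 0 := by
          have := hg n hn
          refine div_nonpos_of_nonpos_of_nonneg (neg_nonpos.2 ?_) hα0.le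
          positivity
        have h2 : P 0 = -((α * v + b) / (α * (α - ρ))) := by
          simp only [P, growthBound_zero, mul_zero, Real.exp_zero]
          field_simp
          ring
        linarith

end CTMDP

namespace CTMDP

section Path

variable {S : Type*}

/-! ### Jump times -/

theorem jumpTime_succ (m : ℕ) (ω : Path S) :
    jumpTime (m + 1) ω = jumpTime m ω + sojourn (m + 1) ω :=
  Finset.sum_range_succ _ _

theorem jumpTime_zero (ω : Path S) : jumpTime 0 ω = 0 := by
  simpa [jumpTime, sojourn] using ω.2.1

theorem jumpTime_mono (ω : Path S) : Monotone fun m => jumpTime m ω :=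
  monotone_nat_of_le_succ fun m => by rw [jumpTime_succ]; exact le_self_add

theorem sojourn_le_jumpTime (m : ℕ) (ω : Path S) : sojourn m ω ≤ jumpTime m ω :=
  Finset.single_le_sum (f := fun i => sojourn i ω) (fun _ _ => zero_le) (by simp)

theorem jumpTime_freeze {i k : ℕ} (hi : i ≤ k) (ω : Path S) :
    jumpTime i (freeze k ω) = jumpTime i ω :=
  Finset.sum_congr rfl fun j hj => by
    have : j ≤ k := by rw [Finset.mem_range] at hj; omega
    simp [sojourn, freeze, this]

theorem mark_freeze {i k : ℕ} (hi : i ≤ k) (ω : Path S) : mark i (freeze k ω) = mark i ω := by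
  simp [mark, freeze, hi]

theorem jumpTime_succ_freeze (k : ℕ) (ω : Path S) : jumpTime (k + 1) (freeze k ω) = ⊤ := by
  rw [jumpTime_succ]
  simp [sojourn, freeze]

theorem state_eq {m : ℕ} {t : ℝ≥0} {ω : Path S} (h1 : jumpTime m ω ≤ t)
    (h2 : (t : ℝ≥0∞) < jumpTime (m + 1) ω) : state t ω = mark m ω := by
  have h : ∃ m, jumpTime m ω ≤ t ∧ (t : ℝ≥0∞) < jumpTime (m + 1) ω := ⟨m, h1, h2⟩
  rw [state, dif_pos h]
  obtain ⟨h3, h4⟩ := h.choose_spec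
  generalize h.choose = n at h3 h4
  rcases lt_trichotomy n m with hnm | rfl | hnm
  · exact absurd ((h4.trans_le (jumpTime_mono ω hnm)).trans_le h1) (lt_irrefl _)
  · rfl
  · exact absurd ((h2.trans_le (jumpTime_mono ω hnm)).trans_le h3) (lt_irrefl _)

theorem leftState_eq {m : ℕ} {t : ℝ≥0} {ω : Path S} (h1 : jumpTime m ω < t)
    (h2 : (t : ℝ≥0∞) ≤ jumpTime (m + 1) ω) : leftState t ω = mark m ω := by
  have h : ∃ m, jumpTime m ω < t ∧ (t : ℝ≥0∞) ≤ jumpTime (m + 1) ω := ⟨m, h1, h2⟩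
  have ht : t ≠ 0 := by
    rintro rfl
    simp at h1
  rw [leftState, if_neg ht, dif_pos h]
  obtain ⟨h3, h4⟩ := h.choose_spec
  generalize h.choose = n at h3 h4
  rcases lt_trichotomy n m with hnm | rfl | hnm
  · exact absurd ((h4.trans (jumpTime_mono ω hnm)).trans_lt h1) (lt_irrefl _)
  · rfl
  · exact absurd ((h2.trans (jumpTime_mono ω hnm)).trans_lt h3) (lt_irrefl _)

/-- Away from the jump times the process agrees with its left limit. -/
theorem leftState_eq_state {t : ℝ≥0} {ω : Path S} (h : ∀ m, jumpTime m ω ≠ t) :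
    leftState t ω = state t ω := by
  by_cases hm : ∃ m, jumpTime m ω ≤ t ∧ (t : ℝ≥0∞) < jumpTime (m + 1) ω
  · obtain ⟨m, h1, h2⟩ := hm
    rw [state_eq h1 h2, leftState_eq (lt_of_le_of_ne h1 (h m)) h2.le]
  · have ht : t ≠ 0 := by
      rintro rfl
      exact h 0 (by simp [jumpTime_zero])
    rw [state, dif_neg hm, leftState, if_neg ht, dif_neg]
    rintro ⟨m, h1, h2⟩
    exact hm ⟨m, h1.le, lt_of_le_of_ne h2 (h (m + 1)).symm⟩

end Path

theorem measurable_sumElim_zero {X S : Type*} [MeasurableSpace X] [MeasurableSpace S]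
    {f : X → S → ℝ≥0∞} (hf : Measurable fun p : X × S => f p.1 p.2) :
    Measurable fun p : X × (S ⊕ Unit) => Sum.elim (f p.1) (fun _ => 0) p.2 := by
  have h : Measurable ((fun p : X × (S ⊕ Unit) => Sum.elim (f p.1) (fun _ => 0) p.2) ∘
      (MeasurableEquiv.prodSumDistrib X S Unit).symm) :=
    measurable_fun_sum hf (measurable_const (a := (0 : ℝ≥0∞)))
  have h' := h.comp (MeasurableEquiv.prodSumDistrib X S Unit).measurable
  rwa [Function.comp_assoc, MeasurableEquiv.symm_comp_self] at h'

variable {S A : Type*} [MeasurableSpace S] [MeasurableSpace A]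

theorem LyapunovCondition.w_nonneg {M : CTMDP S A} {w : S → ℝ} {ρ b : ℝ} {Sl : ℕ → Set S} (hL : M.LyapunovCondition w ρ b Sl) (x : S) : 0 ≤ w x :=
  zero_le_one.trans (hL.one_le_w x)

theorem ae_policy_freeze_mem {M : CTMDP S A} (π : M.Policy) {k : ℕ} {ω : Path S} {x : S}
    (hx : mark k ω = Sum.inl x) (hT : jumpTime k ω ≠ ⊤) {u : ℝ} (hu : 0 < u) :
    ∀ᵐ a ∂π.toFun (freeze k ω) ((jumpTime k ω).toNNReal + u.toNNReal),
      a ∈ Sum.inl '' M.adm x := by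
  have h : leftState ((jumpTime k ω).toNNReal + u.toNNReal) (freeze k ω) = Sum.inl x := by
    rw [← hx, ← mark_freeze le_rfl ω]
    refine leftState_eq ?_ ?_
    · rw [jumpTime_freeze le_rfl, ENNReal.coe_add, ENNReal.coe_toNNReal hT]
      exact ENNReal.lt_add_right hT (by simpa using hu)
    · rw [jumpTime_succ_freeze]
      exact le_top
  have := π.concentrated (freeze k ω) ((jumpTime k ω).toNNReal + u.toNNReal)
  rw [h] at this
  exact this

variable [StandardBorelSpace S]

/-! ### The drift inequality for the jump intensities -/

theorem q_sdiff_singleton (M : CTMDP S A) {x : S} {a : A} (ha : a ∈ M.adm x) :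
    M.q x a (Set.univ \ {x}) = -M.q x a {x} := by
  have := VectorMeasure.of_add_of_sdiff (v := M.q x a) (MeasurableSet.singleton x)
    MeasurableSet.univ (Set.subset_univ _)
  rw [M.q_univ x a ha] at this
  linarith

theorem neg_q_singleton_nonneg (M : CTMDP S A) {x : S} {a : A} (ha : a ∈ M.adm x) :
    0 ≤ -M.q x a {x} := by
  rw [← M.q_sdiff_singleton ha]
  exact M.q_nonneg x a ha _ (MeasurableSet.univ.diff (MeasurableSet.singleton x)) (by simp)

theorem isFiniteMeasure_jumpMeasure (M : CTMDP S A) (x : S) (a : A ⊕ Unit) :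
    IsFiniteMeasure (M.jumpMeasure (Sum.inl x) a) :=
  ⟨(M.jumpMeasure_univ_le x a).trans_lt (M.q_stable x)⟩

/-- The positive and negative parts of `q(· | x, a)` are the jump measure and a point mass at
`x`. -/
theorem toJordanDecomposition_q (M : CTMDP S A) {x : S} {a : A} (ha : a ∈ M.adm x) :
    (M.q x a).toJordanDecomposition.posPart = M.jumpMeasure (Sum.inl x) (Sum.inl a) ∧
      (M.q x a).toJordanDecomposition.negPart =
        ENNReal.ofReal (-M.q x a {x}) • Measure.dirac x := by
  have hfin := M.isFiniteMeasure_jumpMeasure x (Sum.inl a)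
  have hfin' : IsFiniteMeasure (ENNReal.ofReal (-M.q x a {x}) • Measure.dirac x) :=
    Measure.smul_finite _ ENNReal.ofReal_ne_top
  let j : JordanDecomposition S :=
    { posPart := M.jumpMeasure (Sum.inl x) (Sum.inl a)
      negPart := ENNReal.ofReal (-M.q x a {x}) • Measure.dirac x
      mutuallySingular := by
        refine ⟨{x}, MeasurableSet.singleton x, ?_, by simp⟩
        rw [M.jumpMeasure_apply ha (MeasurableSet.singleton x)]
        simp }
  have hj : M.q x a = j.toSignedMeasure := by
    refine VectorMeasure.ext fun Γ hΓ => ?_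
    rw [JordanDecomposition.toSignedMeasure, Measure.toSignedMeasure_sub_apply hΓ]
    simp only [j, Measure.real]
    rw [M.jumpMeasure_apply ha hΓ, ENNReal.toReal_ofReal (M.q_nonneg x a ha _
      (hΓ.diff (MeasurableSet.singleton x)) (by simp)), Measure.smul_apply,
      Measure.dirac_apply' _ hΓ]
    by_cases hx : x ∈ Γ
    · have := VectorMeasure.of_add_of_sdiff (v := M.q x a) (MeasurableSet.singleton x) hΓ
        (Set.singleton_subset_iff.2 hx)
      simp only [hx, Set.indicator_of_mem, Pi.one_apply, smul_eq_mul, mul_one]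
      rw [ENNReal.toReal_ofReal (M.neg_q_singleton_nonneg ha)]
      linarith
    · simp [hx]
  rw [SignedMeasure.toJordanDecomposition_eq hj]
  exact ⟨rfl, rfl⟩

theorem LyapunovCondition.lintegral_jumpMeasure_le {M : CTMDP S A} {w : S → ℝ} {ρ b : ℝ}
    {Sl : ℕ → Set S} (hL : M.LyapunovCondition w ρ b Sl) {x : S} {a : A} (ha : a ∈ M.adm x) :
    ∫⁻ y, ENNReal.ofReal (w y) ∂M.jumpMeasure (Sum.inl x) (Sum.inl a) ≤
      M.jumpMeasure (Sum.inl x) (Sum.inl a) Set.univ * ENNReal.ofReal (w x) +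
        ENNReal.ofReal (ρ * w x + b) := by
  obtain ⟨hint, hd⟩ := hL.drift x a ha
  obtain ⟨hp, hn⟩ := M.toJordanDecomposition_q ha
  rw [SignedMeasure.totalVariation, hp, hn] at hint
  rw [hp, hn, integral_smul_measure, integral_dirac' _ _ hL.measurable_w.stronglyMeasurable,
    ENNReal.toReal_ofReal (M.neg_q_singleton_nonneg ha), smul_eq_mul] at hd
  have hq := M.neg_q_singleton_nonneg ha
  have hw := hL.w_nonneg
  have hρ := hL.rho_nonneg
  have hb := hL.b_nonneg
  rw [← ofReal_integral_eq_lintegral_ofReal hint.left_of_add_measure (ae_of_all _ hw),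
    M.jumpMeasure_apply ha MeasurableSet.univ, M.q_sdiff_singleton ha, ← ENNReal.ofReal_mul hq,
    ← ENNReal.ofReal_add (mul_nonneg hq (hw x)) (by have := hw x; positivity)]
  exact ENNReal.ofReal_le_ofReal (by linarith)

/-! ### One step of the embedded chain -/

theorem LyapunovCondition.lintegral_intensity_le {M : CTMDP S A} {w : S → ℝ} {ρ b : ℝ}
    {Sl : ℕ → Set S} (hL : M.LyapunovCondition w ρ b Sl) (π : M.Policy) {k : ℕ} {ω : Path S}
    {x : S} (hx : mark k ω = Sum.inl x) (hT : jumpTime k ω ≠ ⊤) {u : ℝ} (hu : 0 < u) :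
    ∫⁻ y, ENNReal.ofReal (w y) ∂intensity π k ω u ≤
      intensity π k ω u Set.univ * ENNReal.ofReal (w x) + ENNReal.ofReal (ρ * w x + b) := by
  have hprob := π.isProbabilityMeasure (freeze k ω) ((jumpTime k ω).toNNReal + u.toNNReal)
  have hJ := M.measurable_jumpMeasure_right (Sum.inl x)
  rw [intensity, hx, Measure.lintegral_bind hJ.aemeasurable
    hL.measurable_w.ennreal_ofReal.aemeasurable, Measure.bind_apply MeasurableSet.univ
    hJ.aemeasurable, ← lintegral_mul_const (f := fun a => M.jumpMeasure (Sum.inl x) a Set.univ) _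
      ((Measure.measurable_coe MeasurableSet.univ).comp hJ)]
  calc _ ≤ ∫⁻ a, M.jumpMeasure (Sum.inl x) a Set.univ * ENNReal.ofReal (w x) +
        ENNReal.ofReal (ρ * w x + b)
          ∂π.toFun (freeze k ω) ((jumpTime k ω).toNNReal + u.toNNReal) := by
        refine lintegral_mono_ae ((ae_policy_freeze_mem π hx hT hu).mono ?_)
        rintro _ ⟨a, ha, rfl⟩
        exact hL.lintegral_jumpMeasure_le ha
    _ = _ := by
        rw [lintegral_add_right _ measurable_const]
        simp

theorem LyapunovCondition.lintegral_growthBound_intensity_le {M : CTMDP S A} {w : S → ℝ}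
    {ρ b : ℝ} {Sl : ℕ → Set S} (hL : M.LyapunovCondition w ρ b Sl) (π : M.Policy) {k : ℕ}
    {ω : Path S} {x : S} (hx : mark k ω = Sum.inl x) (hT : jumpTime k ω ≠ ⊤) {u : ℝ} (hu : 0 < u)
    {r : ℝ} (hr : 0 ≤ r) :
    ∫⁻ y, ENNReal.ofReal (growthBound ρ b r (w y)) ∂intensity π k ω u ≤
      intensity π k ω u Set.univ * ENNReal.ofReal (growthBound ρ b r (w x)) +
        ENNReal.ofReal (Real.exp (ρ * r) * (ρ * w x + b)) := by
  have he := (Real.exp_pos (ρ * r)).le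
  have h0 := growthBound_zero_nonneg hL.rho_nonneg hL.b_nonneg hr
  have h : ∀ y, ENNReal.ofReal (growthBound ρ b r (w y)) = ENNReal.ofReal (Real.exp (ρ * r)) *
      ENNReal.ofReal (w y) + ENNReal.ofReal (growthBound ρ b r 0) := fun y => by
    rw [growthBound_eq, ENNReal.ofReal_add (mul_nonneg he (hL.w_nonneg y)) h0,
      ENNReal.ofReal_mul he]
  simp_rw [h]
  rw [lintegral_add_right _ measurable_const, lintegral_const,
    lintegral_const_mul _ hL.measurable_w.ennreal_ofReal, ENNReal.ofReal_mul he]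
  grw [hL.lintegral_intensity_le π hx hT hu]
  exact le_of_eq (by ring)

theorem lintegral_stepMeasure {M : CTMDP S A} (π : M.Policy) {k : ℕ} {ω : Path S}
    (hθ : sojourn k ω ≠ ⊤) {H : ℝ≥0∞ × (S ⊕ Unit) → ℝ≥0∞} (hH : Measurable H) :
    ∫⁻ e, H e ∂stepMeasure π k ω =
      (∫⁻ u in Set.Ioi (0 : ℝ), survival π k ω u *
        ∫⁻ y, H (ENNReal.ofReal u, Sum.inl y) ∂intensity π k ω u) +
      noJump π k ω * H (⊤, Sum.inr ()) := by
  rw [stepMeasure, if_neg hθ, lintegral_add_measure, lintegral_smul_measure,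
    lintegral_dirac' _ hH, Measure.lintegral_bind (measurable_density_right π k ω).aemeasurable
    hH.aemeasurable, smul_eq_mul]
  congr 1
  refine lintegral_congr fun u => ?_
  rw [lintegral_map hH (measurable_const.prodMk measurable_inl), lintegral_smul_measure,
    smul_eq_mul]

theorem setLIntegral_stepMeasure {M : CTMDP S A} (π : M.Policy) {k : ℕ} {ω : Path S}
    (hθ : sojourn k ω ≠ ⊤) {H : ℝ≥0∞ × (S ⊕ Unit) → ℝ≥0∞} (hH : Measurable H) (s : ℝ) :
    ∫⁻ e in {e | e.1 ≤ ENNReal.ofReal s}, H e ∂stepMeasure π k ω =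
      ∫⁻ u in Set.Ioc 0 s, survival π k ω u *
        ∫⁻ y, H (ENNReal.ofReal u, Sum.inl y) ∂intensity π k ω u := by
  have hD : MeasurableSet {e : ℝ≥0∞ × (S ⊕ Unit) | e.1 ≤ ENNReal.ofReal s} :=
    measurable_fst measurableSet_Iic
  rw [← lintegral_indicator hD, lintegral_stepMeasure π hθ (hH.indicator hD),
    Set.indicator_of_notMem (by simp), mul_zero, add_zero, ← lintegral_indicator measurableSet_Ioc,
    ← lintegral_indicator measurableSet_Ioi]
  refine lintegral_congr fun u => ?_
  by_cases hu : 0 < u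
  · rw [Set.indicator_of_mem (show u ∈ Set.Ioi 0 from hu)]
    by_cases hus : u ≤ s
    · rw [Set.indicator_of_mem (show u ∈ Set.Ioc 0 s from ⟨hu, hus⟩)]
      congr 1
      refine lintegral_congr fun y => Set.indicator_of_mem ?_ _
      exact ENNReal.ofReal_le_ofReal hus
    · rw [Set.indicator_of_notMem (fun h : u ∈ Set.Ioc 0 s => hus h.2)]
      have : ∀ y : S, (ENNReal.ofReal u, (Sum.inl y : S ⊕ Unit)) ∉
          {e : ℝ≥0∞ × (S ⊕ Unit) | e.1 ≤ ENNReal.ofReal s} := fun y h => by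
        have h' : ENNReal.ofReal u ≤ ENNReal.ofReal s := h
        rw [ENNReal.ofReal_le_ofReal_iff'] at h'
        rcases h' with h' | h' <;> linarith
      simp_rw [Set.indicator_of_notMem (this _)]
      simp
  · rw [Set.indicator_of_notMem (fun h : u ∈ Set.Ioi 0 => hu h),
      Set.indicator_of_notMem (fun h : u ∈ Set.Ioc 0 s => hu h.1)]

/-- The sojourn time after the `k`-th jump exceeds `s` with the probability `survival π k ω s`. -/
theorem stepMeasure_lt {M : CTMDP S A} (π : M.Policy) {k : ℕ} {ω : Path S}
    (hθ : sojourn k ω ≠ ⊤) {s : ℝ} (hs : 0 ≤ s) :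
    stepMeasure π k ω {e | ENNReal.ofReal s < e.1} = survival π k ω s := by
  obtain ⟨x, hx⟩ := mark_eq_inl hθ
  have hprob := isProbabilityMeasure_stepMeasure π k ω
  have hD : MeasurableSet {e : ℝ≥0∞ × (S ⊕ Unit) | e.1 ≤ ENNReal.ofReal s} :=
    measurable_fst measurableSet_Iic
  have h1 := exp_neg_mul_add_lintegral (measurable_intensity_univ_right π k ω) (M.q_stable x)
    (intensity_univ_le π k ω hx) (g := fun _ => 1) (d := fun _ => 0)
    (fun u => by simpa using hasDerivAt_const u (1 : ℝ)) continuous_const hs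
    (fun _ _ => zero_le_one) (fun _ => le_rfl)
  have h2 := setLIntegral_stepMeasure π hθ (H := fun _ => 1) measurable_const s
  simp only [lintegral_const, one_mul, Measure.restrict_apply MeasurableSet.univ,
    Set.univ_inter] at h2
  simp only [ENNReal.ofReal_one, mul_one, ENNReal.ofReal_zero, add_zero] at h1
  have h3 := (add_comm _ _).trans (prob_add_prob_compl (μ := stepMeasure π k ω) hD)
  have h4 : {e : ℝ≥0∞ × (S ⊕ Unit) | e.1 ≤ ENNReal.ofReal s}ᶜ = {e | ENNReal.ofReal s < e.1} := by
    ext e; simp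
  rw [h4] at h3
  have h5 : survival π k ω s + stepMeasure π k ω {e | e.1 ≤ ENNReal.ofReal s} = 1 := by
    rw [h2]; exact h1
  exact (ENNReal.add_left_inj (measure_ne_top _ _)).1 (h3.trans h5.symm)

theorem exp_neg_maxRate_le_survival {M : CTMDP S A} (π : M.Policy) {k : ℕ} {ω : Path S}
    {x : S} (hx : mark k ω = Sum.inl x) :
    EReal.exp (-(M.maxRate x : EReal)) ≤ survival π k ω 1 := by
  refine EReal.exp_monotone (EReal.neg_le_neg_iff.2 (EReal.coe_ennreal_le_coe_ennreal_iff.2 ?_))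
  refine (lintegral_mono fun u => intensity_univ_le π k ω hx u).trans ?_
  simp

/-- One step decreases the expected growth bound. -/
theorem LyapunovCondition.step_le {M : CTMDP S A} {w : S → ℝ} {ρ b : ℝ}
    {Sl : ℕ → Set S} (hL : M.LyapunovCondition w ρ b Sl) (π : M.Policy) {k : ℕ} {ω : Path S}
    {x : S} (hx : mark k ω = Sum.inl x) (hT : jumpTime k ω ≠ ⊤) {s : ℝ} (hs : 0 ≤ s) :
    stepMeasure π k ω {e | ENNReal.ofReal s < e.1} * ENNReal.ofReal (w x) +
      ∫⁻ e in {e | e.1 ≤ ENNReal.ofReal s},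
        Sum.elim (fun y => ENNReal.ofReal (growthBound ρ b (s - e.1.toReal) (w y))) (fun _ => 0) e.2
        ∂stepMeasure π k ω ≤ ENNReal.ofReal (growthBound ρ b s (w x)) := by
  have hθ : sojourn k ω ≠ ⊤ := ((sojourn_le_jumpTime k ω).trans_lt hT.lt_top).ne
  have hH : Measurable fun e : ℝ≥0∞ × (S ⊕ Unit) => Sum.elim
      (fun y => ENNReal.ofReal (growthBound ρ b (s - e.1.toReal) (w y)))
      (fun _ => (0 : ℝ≥0∞)) e.2 := by
    refine measurable_sumElim_zero (X := ℝ≥0∞)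
      (f := fun θ y => ENNReal.ofReal (growthBound ρ b (s - θ.toReal) (w y))) ?_
    exact ((continuous_growthBound ρ b).measurable.comp ((measurable_const.sub
      measurable_fst.ennreal_toReal).prodMk (hL.measurable_w.comp measurable_snd))).ennreal_ofReal
  rw [stepMeasure_lt π hθ hs, setLIntegral_stepMeasure π hθ hH]
  have hρ := hL.rho_nonneg
  have hb := hL.b_nonneg
  have hw := hL.w_nonneg x
  have key := exp_neg_mul_add_lintegral (measurable_intensity_univ_right π k ω) (M.q_stable x)
    (intensity_univ_le π k ω hx) (g := fun u => growthBound ρ b (s - u) (w x))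
    (d := fun u => Real.exp (ρ * (s - u)) * (ρ * w x + b))
    (fun u => (((hasDerivAt_growthBound ρ b (s - u) (w x)).comp u
      ((hasDerivAt_id u).const_sub s))).congr_deriv (by ring)) (by fun_prop) hs
    (fun u hu => hw.trans (le_growthBound hρ hb (sub_nonneg.2 hu) hw)) (fun u => by positivity)
  simp only [sub_self, growthBound_zero, sub_zero] at key
  rw [← key]
  refine add_le_add le_rfl (setLIntegral_mono' measurableSet_Ioc fun u hu => ?_)
  refine mul_le_mul_right ?_ _
  simp only [Sum.elim_inl, ENNReal.toReal_ofReal hu.1.le]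
  exact hL.lintegral_growthBound_intensity_le π hx hT hu.1 (sub_nonneg.2 hu.2)

end CTMDP

namespace CTMDP

theorem indicator_apply_congr {α β γ : Type*} [Zero γ] {s : Set α} {t : Set β} {f : α → γ}
    {g : β → γ} {a : α} {b : β} (h : a ∈ s ↔ b ∈ t) (hfg : a ∈ s → f a = g b) :
    s.indicator f a = t.indicator g b := by
  by_cases ha : a ∈ s
  · rw [Set.indicator_of_mem ha, Set.indicator_of_mem (h.1 ha), hfg ha]
  · rw [Set.indicator_of_notMem ha, Set.indicator_of_notMem (mt h.2 ha)]

theorem indicator_indicator_apply_congr {α β γ : Type*} [Zero γ] {s s' : Set α} {t : Set β}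
    {f : α → γ} {g : β → γ} {a : α} {b : β} (h : a ∈ s ∩ s' ↔ b ∈ t)
    (hfg : a ∈ s ∩ s' → f a = g b) :
    s.indicator (fun x => s'.indicator f x) a = t.indicator g b := by
  rw [Set.indicator_indicator]
  exact indicator_apply_congr h hfg

section Functionals

variable {S : Type*}

/-- The function `w`, extended by zero to `x_∞`. -/
noncomputable def extWeight (w : S → ℝ) : S ⊕ Unit → ℝ≥0∞ :=
  Sum.elim (fun y => ENNReal.ofReal (w y)) (fun _ => 0)

/-- The growth bound started from `w`, extended by zero to `x_∞`. -/
noncomputable def extGrowth (ρ b : ℝ) (w : S → ℝ) (r : ℝ) : S ⊕ Unit → ℝ≥0∞ :=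
  Sum.elim (fun y => ENNReal.ofReal (growthBound ρ b r (w y))) (fun _ => 0)

/-- The weight `w(x_m)` if the process at the time `t` is between the jumps `m` and `m + 1`. -/
noncomputable def occupation (w : S → ℝ) (m : ℕ) (t : ℝ≥0) (ω : Path S) : ℝ≥0∞ :=
  {ω | jumpTime m ω ≤ t ∧ (t : ℝ≥0∞) < jumpTime (m + 1) ω}.indicator
    (fun ω => extWeight w (mark m ω)) ω

/-- The growth bound over the time that remains until `t` after the `m`-th jump. -/
noncomputable def remainder (ρ b : ℝ) (w : S → ℝ) (m : ℕ) (t : ℝ≥0) (ω : Path S) : ℝ≥0∞ :=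
  {ω | jumpTime m ω ≤ t}.indicator
    (fun ω => extGrowth ρ b w (t - (jumpTime m ω).toReal) (mark m ω)) ω

theorem extWeight_state (w : S → ℝ) (t : ℝ≥0) (ω : Path S) :
    extWeight w (state t ω) = ∑' m, occupation w m t ω := by
  by_cases h : ∃ m, jumpTime m ω ≤ t ∧ (t : ℝ≥0∞) < jumpTime (m + 1) ω
  · obtain ⟨m, h1, h2⟩ := h
    rw [tsum_eq_single m, state_eq h1 h2, occupation, Set.indicator_of_mem (by exact ⟨h1, h2⟩)]
    intro n hn
    refine Set.indicator_of_notMem ?_ _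
    rintro ⟨h3, h4⟩
    rcases lt_or_gt_of_ne hn with hnm | hnm
    · exact absurd ((h4.trans_le (jumpTime_mono ω hnm)).trans_le h1) (lt_irrefl _)
    · exact absurd ((h2.trans_le (jumpTime_mono ω hnm)).trans_le h3) (lt_irrefl _)
  · have h0 : ∀ m, occupation w m t ω = 0 := fun m => by
      rw [occupation, Set.indicator_of_notMem]
      exact fun h' => h ⟨m, h'⟩
    rw [state, dif_neg h, ENNReal.tsum_eq_zero.2 h0]
    rfl

theorem sum_indicator_one_lt_sojourn_le (t : ℝ≥0) (ω : Path S) (n : ℕ) :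
    ∑ m ∈ Finset.range n, {ω | jumpTime m ω ≤ t ∧ 1 < sojourn (m + 1) ω}.indicator
      (fun _ => (1 : ℝ≥0∞)) ω ≤ min (jumpTime n ω) (t + 1) := by
  induction n with
  | zero => simp
  | succ n ih =>
    rw [Finset.sum_range_succ, jumpTime_succ]
    by_cases h : jumpTime n ω ≤ t ∧ 1 < sojourn (n + 1) ω
    · rw [Set.indicator_of_mem (by exact h)]
      have hle := ih.trans (min_le_left _ _)
      exact le_min (add_le_add hle h.2.le) (add_le_add (hle.trans h.1) le_rfl)
    · rw [Set.indicator_of_notMem (by exact h), add_zero]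
      exact ih.trans (min_le_min le_self_add le_rfl)

end Functionals

variable {S A : Type*} [MeasurableSpace S] [MeasurableSpace A]

theorem measurable_extWeight {w : S → ℝ} (hw : Measurable w) : Measurable (extWeight w) :=
  measurable_fun_sum hw.ennreal_ofReal measurable_const

theorem measurable_extGrowth (ρ b : ℝ) {w : S → ℝ} (hw : Measurable w) :
    Measurable fun p : ℝ × (S ⊕ Unit) => extGrowth ρ b w p.1 p.2 :=
  measurable_sumElim_zero (f := fun r y => ENNReal.ofReal (growthBound ρ b r (w y)))
    ((continuous_growthBound ρ b).measurable.comp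
      (measurable_fst.prodMk (hw.comp measurable_snd))).ennreal_ofReal

theorem measurable_occupation {w : S → ℝ} (hw : Measurable w) (m : ℕ) :
    Measurable fun p : Path S × ℝ≥0 => occupation w m p.2 p.1 := by
  have hs : MeasurableSet {p : Path S × ℝ≥0 | jumpTime m p.1 ≤ p.2 ∧
      (p.2 : ℝ≥0∞) < jumpTime (m + 1) p.1} :=
    (measurableSet_le ((measurable_jumpTime m).comp measurable_fst)
      measurable_snd.coe_nnreal_ennreal).inter
      (measurableSet_lt measurable_snd.coe_nnreal_ennreal
        ((measurable_jumpTime (m + 1)).comp measurable_fst))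
  exact ((measurable_extWeight hw).comp ((measurable_mark m).comp measurable_fst)).indicator hs

theorem measurable_extWeight_state {w : S → ℝ} (hw : Measurable w) :
    Measurable fun p : Path S × ℝ≥0 => extWeight w (state p.2 p.1) := by
  simp_rw [extWeight_state]
  exact Measurable.tsum fun m => measurable_occupation hw m

variable [StandardBorelSpace S]

/-- The expectation of a function of the history up to the `k`-th jump and the next jump. -/
theorem lintegral_law_step {M : CTMDP S A} (π : M.Policy) (γ : Measure S)
    [IsProbabilityMeasure γ] (k : ℕ) {H : Path S × (ℝ≥0∞ × (S ⊕ Unit)) → ℝ≥0∞}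
    (hH : Measurable H) :
    ∫⁻ ω, H (freeze k ω, ω.1 (k + 1)) ∂law π γ =
      ∫⁻ ω, ∫⁻ e, H (freeze k ω, e) ∂stepMeasure π k ω ∂law π γ := by
  let κ : Kernel (Path S) (ℝ≥0∞ × (S ⊕ Unit)) := ⟨stepMeasure π k, measurable_stepMeasure π k⟩
  have : IsMarkovKernel κ := ⟨isProbabilityMeasure_stepMeasure π k⟩
  have hfr := measurable_freeze (S := S) k
  have hpair : Measurable fun ω : Path S => (freeze k ω, ω.1 (k + 1)) :=
    hfr.prodMk ((measurable_pi_apply (k + 1)).comp measurable_subtype_coe)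
  have hlaw : (law π γ).map (fun ω => (freeze k ω, ω.1 (k + 1))) =
      ((law π γ).map (freeze k)) ⊗ₘ κ := by
    have : IsProbabilityMeasure ((law π γ).map fun ω => (freeze k ω, ω.1 (k + 1))) :=
      Measure.isProbabilityMeasure_map hpair.aemeasurable
    refine Measure.ext_prod fun {B D} hB hD => ?_
    rw [Measure.map_apply hpair (hB.prod hD), Measure.compProd_apply_prod hB hD,
      setLIntegral_map hB (κ.measurable_coe hD) hfr]
    simp only [κ, Kernel.coe_mk, stepMeasure_freeze]
    exact law_step π γ k hB hD
  rw [← lintegral_map hH hpair, hlaw, Measure.lintegral_compProd hH,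
    lintegral_map hH.lintegral_kernel_prod_right' hfr]
  simp only [κ, Kernel.coe_mk, stepMeasure_freeze]

theorem LyapunovCondition.lintegral_occupation_add_le {M : CTMDP S A} {w : S → ℝ} {ρ b : ℝ}
    {Sl : ℕ → Set S} (hL : M.LyapunovCondition w ρ b Sl) (π : M.Policy) (γ : Measure S)
    [IsProbabilityMeasure γ] {B : Set (S ⊕ Unit)} (hB : MeasurableSet B) (k : ℕ) (t : ℝ≥0) :
    ∫⁻ ω in mark 0 ⁻¹' B, occupation w k t ω ∂law π γ +
        ∫⁻ ω in mark 0 ⁻¹' B, remainder ρ b w (k + 1) t ω ∂law π γ ≤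
      ∫⁻ ω in mark 0 ⁻¹' B, remainder ρ b w k t ω ∂law π γ := by
  have hB0 : MeasurableSet (mark 0 ⁻¹' B : Set (Path S)) := measurable_mark 0 hB
  have hT : Measurable fun p : Path S × (ℝ≥0∞ × (S ⊕ Unit)) => jumpTime k p.1 + p.2.1 :=
    ((measurable_jumpTime k).comp measurable_fst).add measurable_snd.fst
  have hQ : MeasurableSet {p : Path S × (ℝ≥0∞ × (S ⊕ Unit)) | mark 0 p.1 ∈ B ∧
      jumpTime k p.1 ≤ t} :=
    measurable_fst (hB0.inter (measurable_jumpTime k measurableSet_Iic))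
  let H₁ : Path S × (ℝ≥0∞ × (S ⊕ Unit)) → ℝ≥0∞ :=
    ({p | mark 0 p.1 ∈ B ∧ jumpTime k p.1 ≤ t} ∩
      {p | (t : ℝ≥0∞) < jumpTime k p.1 + p.2.1}).indicator fun p => extWeight w (mark k p.1)
  let H₂ : Path S × (ℝ≥0∞ × (S ⊕ Unit)) → ℝ≥0∞ :=
    ({p | mark 0 p.1 ∈ B ∧ jumpTime k p.1 ≤ t} ∩
      {p | jumpTime k p.1 + p.2.1 ≤ t}).indicator fun p =>
        extGrowth ρ b w (t - (jumpTime k p.1 + p.2.1).toReal) p.2.2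
  have hH₁ : Measurable H₁ :=
    ((measurable_extWeight hL.measurable_w).comp
      ((measurable_mark k).comp measurable_fst)).indicator (hQ.inter (hT measurableSet_Ioi))
  have hH₂ : Measurable H₂ :=
    ((measurable_extGrowth ρ b hL.measurable_w).comp
      ((measurable_const.sub hT.ennreal_toReal).prodMk measurable_snd.snd)).indicator
      (hQ.inter (hT measurableSet_Iic))
  have h0 : ∀ ω : Path S, mark 0 (freeze k ω) = mark 0 ω := mark_freeze (Nat.zero_le k)
  have hk : ∀ ω : Path S, mark k (freeze k ω) = mark k ω := mark_freeze le_rfl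
  have hTk : ∀ ω : Path S, jumpTime k (freeze k ω) = jumpTime k ω := jumpTime_freeze le_rfl
  have hsucc : ∀ ω : Path S, jumpTime k ω + (ω.1 (k + 1)).1 = jumpTime (k + 1) ω := fun ω =>
    (jumpTime_succ k ω).symm
  have e₁ : ∫⁻ ω in mark 0 ⁻¹' B, occupation w k t ω ∂law π γ =
      ∫⁻ ω, H₁ (freeze k ω, ω.1 (k + 1)) ∂law π γ := by
    rw [← lintegral_indicator hB0]
    refine lintegral_congr fun ω => ?_
    refine indicator_indicator_apply_congr ?_ fun _ => by rw [hk]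
    simp only [Set.mem_preimage, Set.mem_inter_iff, Set.mem_ofPred_eq, h0, hTk, hsucc, and_assoc]
  have e₂ : ∫⁻ ω in mark 0 ⁻¹' B, remainder ρ b w (k + 1) t ω ∂law π γ =
      ∫⁻ ω, H₂ (freeze k ω, ω.1 (k + 1)) ∂law π γ := by
    rw [← lintegral_indicator hB0]
    refine lintegral_congr fun ω => ?_
    have hmono : jumpTime (k + 1) ω ≤ t → jumpTime k ω ≤ t :=
      (jumpTime_mono ω (Nat.le_succ k)).trans
    refine indicator_indicator_apply_congr ?_ fun _ => by rw [hTk, hsucc]; rfl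
    simp only [Set.mem_preimage, Set.mem_inter_iff, Set.mem_ofPred_eq, h0, hTk, hsucc]
    tauto
  rw [e₁, e₂, lintegral_law_step π γ k hH₁, lintegral_law_step π γ k hH₂]
  have hm₁ : Measurable fun ω => ∫⁻ e, H₁ (freeze k ω, e) ∂stepMeasure π k ω := by
    let κ : Kernel (Path S) (ℝ≥0∞ × (S ⊕ Unit)) := ⟨stepMeasure π k, measurable_stepMeasure π k⟩
    have : IsMarkovKernel κ := ⟨isProbabilityMeasure_stepMeasure π k⟩
    exact Measurable.lintegral_kernel_prod_right' (κ := κ)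
      (hH₁.comp (((measurable_freeze k).comp measurable_fst).prodMk measurable_snd))
  rw [← lintegral_add_left hm₁, ← lintegral_indicator hB0]
  refine lintegral_mono fun ω => ?_
  by_cases hω : mark 0 ω ∈ B ∧ jumpTime k ω ≤ t
  swap
  · have z₁ : ∀ e, H₁ (freeze k ω, e) = 0 := fun e => Set.indicator_of_notMem
      (fun h => hω (by simpa only [Set.mem_ofPred_eq, h0, hTk] using h.1)) _
    have z₂ : ∀ e, H₂ (freeze k ω, e) = 0 := fun e => Set.indicator_of_notMem
      (fun h => hω (by simpa only [Set.mem_ofPred_eq, h0, hTk] using h.1)) _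
    simp [z₁, z₂]
  obtain ⟨hω0, hωt⟩ := hω
  have hTtop : jumpTime k ω ≠ ⊤ := ne_top_of_le_ne_top ENNReal.coe_ne_top hωt
  obtain ⟨x, hx⟩ := mark_eq_inl ((sojourn_le_jumpTime k ω).trans_lt hTtop.lt_top).ne
  have hs : 0 ≤ (t : ℝ) - (jumpTime k ω).toReal := by
    have := ENNReal.toReal_mono ENNReal.coe_ne_top hωt
    simpa using this
  have hst : (t : ℝ≥0∞) = jumpTime k ω + ENNReal.ofReal (t - (jumpTime k ω).toReal) := by
    rw [← ENNReal.ofReal_toReal hTtop, ENNReal.toReal_ofReal ENNReal.toReal_nonneg,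
      ← ENNReal.ofReal_add ENNReal.toReal_nonneg hs]
    simp
  have hle : ∀ θ, jumpTime k ω + θ ≤ t ↔ θ ≤ ENNReal.ofReal (t - (jumpTime k ω).toReal) :=
    fun θ => by
      conv_lhs => rw [hst]
      exact ENNReal.add_le_add_iff_left hTtop
  have key := hL.step_le π hx hTtop hs
  have i₁ : ∫⁻ e, H₁ (freeze k ω, e) ∂stepMeasure π k ω = stepMeasure π k ω
      {e | ENNReal.ofReal (t - (jumpTime k ω).toReal) < e.1} * ENNReal.ofReal (w x) := by
    rw [mul_comm, ← lintegral_indicator_const (s := {e : ℝ≥0∞ × (S ⊕ Unit) |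
      ENNReal.ofReal (t - (jumpTime k ω).toReal) < e.1}) (measurable_fst measurableSet_Ioi)]
    refine lintegral_congr fun e => indicator_apply_congr ?_ fun _ => by rw [hk, hx]; rfl
    simp only [Set.mem_inter_iff, Set.mem_ofPred_eq, h0, hTk, hω0, hωt, true_and, ← not_le, hle,
      and_self]
  have i₂ : ∫⁻ e, H₂ (freeze k ω, e) ∂stepMeasure π k ω =
      ∫⁻ e in {e | e.1 ≤ ENNReal.ofReal (t - (jumpTime k ω).toReal)},
        Sum.elim (fun y => ENNReal.ofReal (growthBound ρ b
          (t - (jumpTime k ω).toReal - e.1.toReal) (w y))) (fun _ => 0) e.2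
        ∂stepMeasure π k ω := by
    rw [← lintegral_indicator (s := {e : ℝ≥0∞ × (S ⊕ Unit) |
      e.1 ≤ ENNReal.ofReal (t - (jumpTime k ω).toReal)}) (measurable_fst measurableSet_Iic)]
    refine lintegral_congr fun e => indicator_apply_congr ?_ fun he => ?_
    · simp only [Set.mem_inter_iff, Set.mem_ofPred_eq, h0, hTk, hω0, hωt, true_and, hle, and_self]
    · have he' : jumpTime k (freeze k ω) + e.1 ≤ t := he.2
      rw [hTk] at he' ⊢
      rw [ENNReal.toReal_add hTtop (ne_top_of_le_ne_top ENNReal.ofReal_ne_top ((hle _).1 he')),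
        ← sub_sub]
      rfl
  rw [i₁, i₂, Set.indicator_of_mem (show ω ∈ mark 0 ⁻¹' B from hω0), remainder,
    Set.indicator_of_mem (by exact hωt), hx]
  exact key

end CTMDP

namespace CTMDP

variable {S A : Type*} [MeasurableSpace S] [MeasurableSpace A] [StandardBorelSpace S]

theorem LyapunovCondition.sum_lintegral_occupation_add_le {M : CTMDP S A} {w : S → ℝ} {ρ b : ℝ}
    {Sl : ℕ → Set S} (hL : M.LyapunovCondition w ρ b Sl) (π : M.Policy) (γ : Measure S)
    [IsProbabilityMeasure γ] {B : Set S} (hB : MeasurableSet B) (n : ℕ) (t : ℝ≥0) :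
    ∑ m ∈ Finset.range n, ∫⁻ ω in mark 0 ⁻¹' (Sum.inl '' B), occupation w m t ω ∂law π γ +
        ∫⁻ ω in mark 0 ⁻¹' (Sum.inl '' B), remainder ρ b w n t ω ∂law π γ ≤
      ∫⁻ x in B, ENNReal.ofReal (growthBound ρ b t (w x)) ∂γ := by
  have hB' : MeasurableSet (Sum.inl '' B : Set (S ⊕ Unit)) := measurableSet_inl_image.2 hB
  induction n with
  | zero =>
    have hG : Measurable (extGrowth ρ b w t) :=
      (measurable_extGrowth ρ b hL.measurable_w).comp (measurable_const.prodMk measurable_id)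
    have h : ∀ ω : Path S, remainder ρ b w 0 t ω = extGrowth ρ b w t (mark 0 ω) := fun ω => by
      rw [remainder, Set.indicator_of_mem (by simp [jumpTime_zero])]
      simp [jumpTime_zero]
    simp_rw [h]
    rw [Finset.range_zero, Finset.sum_empty, zero_add,
      ← setLIntegral_map hB' hG (measurable_mark 0), law_map_mark_zero,
      setLIntegral_map hB' hG measurable_inl, Set.preimage_image_eq _ Sum.inl_injective]
    exact le_rfl
  | succ n ih =>
    rw [Finset.sum_range_succ, add_assoc]
    exact (add_le_add le_rfl (hL.lintegral_occupation_add_le π γ hB' n t)).trans ih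

theorem LyapunovCondition.lintegral_extWeight_state_le {M : CTMDP S A} {w : S → ℝ} {ρ b : ℝ}
    {Sl : ℕ → Set S} (hL : M.LyapunovCondition w ρ b Sl) (π : M.Policy) (γ : Measure S)
    [IsProbabilityMeasure γ] (t : ℝ≥0) :
    ∫⁻ ω, extWeight w (state t ω) ∂law π γ ≤
      ∫⁻ x, ENNReal.ofReal (growthBound ρ b t (w x)) ∂γ := by
  have hm : ∀ m, Measurable (occupation w m t : Path S → ℝ≥0∞) := fun m =>
    (measurable_occupation hL.measurable_w m).comp (measurable_id.prodMk measurable_const)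
  simp_rw [extWeight_state]
  rw [lintegral_tsum fun m => (hm m).aemeasurable]
  refine ENNReal.tsum_le_of_sum_range_le fun n => ?_
  have h := hL.sum_lintegral_occupation_add_le π γ MeasurableSet.univ n t
  have huniv : (mark 0 ⁻¹' (Sum.inl '' Set.univ) : Set (Path S)) = Set.univ := by
    refine Set.eq_univ_of_forall fun ω => ?_
    rw [Set.image_univ]
    exact ω.2.2.1
  simp only [huniv, Measure.restrict_univ] at h
  exact le_self_add.trans h

/-! ### Nonexplosion -/

theorem LyapunovCondition.tsum_law_mark_mem_ne_top {M : CTMDP S A} {w : S → ℝ} {ρ b : ℝ}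
    {Sl : ℕ → Set S} (hL : M.LyapunovCondition w ρ b Sl) (π : M.Policy) (γ : Measure S)
    [IsProbabilityMeasure γ] (t : ℝ≥0) (l : ℕ) :
    ∑' n, law π γ {ω | jumpTime n ω ≤ t ∧ mark n ω ∈ Sum.inl '' Sl l} ≠ ⊤ := by
  set C : ℝ≥0∞ := ⨆ x ∈ Sl l, M.maxRate x with hC
  have hCtop : C ≠ ⊤ := (hL.rates_bounded l).ne
  have hε : EReal.exp (-(C : EReal)) ≠ 0 := by
    simpa [EReal.exp_eq_zero_iff] using hCtop
  have hms : ∀ n, MeasurableSet {ω : Path S | jumpTime n ω ≤ t ∧ 1 < sojourn (n + 1) ω} :=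
    fun n => (measurable_jumpTime n measurableSet_Iic).inter
      (measurable_sojourn (n + 1) measurableSet_Ioi)
  have h1 : ∑' n, law π γ {ω | jumpTime n ω ≤ t ∧ 1 < sojourn (n + 1) ω} ≤ t + 1 := by
    refine ENNReal.tsum_le_of_sum_range_le fun n => ?_
    simp_rw [← lintegral_indicator_one (hms _)]
    rw [← lintegral_finsetSum _ fun m _ => measurable_one.indicator (hms m)]
    refine (lintegral_mono fun ω => (sum_indicator_one_lt_sojourn_le t ω n).trans
      (min_le_right _ _)).trans ?_
    simp
  have h2 : ∀ n, EReal.exp (-(C : EReal)) *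
      law π γ {ω | jumpTime n ω ≤ t ∧ mark n ω ∈ Sum.inl '' Sl l} ≤
      law π γ {ω | jumpTime n ω ≤ t ∧ 1 < sojourn (n + 1) ω} := by
    intro n
    have hms' : MeasurableSet {ω : Path S | jumpTime n ω ≤ t ∧ mark n ω ∈ Sum.inl '' Sl l} :=
      (measurable_jumpTime n measurableSet_Iic).inter
        (measurable_mark n (measurableSet_inl_image.2 (hL.measurableSet_Sl l)))
    have hstep := law_step π γ n (B := {ω | jumpTime n ω ≤ t})
      (measurable_jumpTime n measurableSet_Iic) (D := {e | ENNReal.ofReal 1 < e.1})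
      (measurable_fst measurableSet_Ioi)
    have e1 : {ω : Path S | freeze n ω ∈ {ω : Path S | jumpTime n ω ≤ t} ∧
        ω.1 (n + 1) ∈ {e : ℝ≥0∞ × (S ⊕ Unit) | ENNReal.ofReal 1 < e.1}} =
        {ω | jumpTime n ω ≤ t ∧ 1 < sojourn (n + 1) ω} := by
      ext ω
      simp only [Set.mem_ofPred_eq, jumpTime_freeze le_rfl, ENNReal.ofReal_one]
      rfl
    have e2 : freeze n ⁻¹' {ω : Path S | jumpTime n ω ≤ t} = {ω | jumpTime n ω ≤ t} := by
      ext ω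
      simp only [Set.mem_preimage, Set.mem_ofPred_eq, jumpTime_freeze le_rfl]
    rw [e1, e2] at hstep
    rw [hstep, ← setLIntegral_const]
    refine (setLIntegral_mono' hms' fun ω hω => ?_).trans
      (lintegral_mono_set fun ω hω => hω.1)
    obtain ⟨hωt, x, hx, hxm⟩ := hω
    have hθ : sojourn n ω ≠ ⊤ :=
      ne_top_of_le_ne_top ENNReal.coe_ne_top ((sojourn_le_jumpTime n ω).trans hωt)
    rw [stepMeasure_lt π hθ zero_le_one]
    refine le_trans (EReal.exp_monotone (EReal.neg_le_neg_iff.2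
      (EReal.coe_ennreal_le_coe_ennreal_iff.2 ?_))) (exp_neg_maxRate_le_survival π hxm.symm)
    exact le_iSup₂ (f := fun x (_ : x ∈ Sl l) => M.maxRate x) x hx
  intro htop
  have h3 := (ENNReal.tsum_le_tsum h2).trans h1
  rw [ENNReal.tsum_mul_left, htop, ENNReal.mul_top hε] at h3
  exact absurd h3 (by simp)

theorem LyapunovCondition.law_forall_jumpTime_le_eq_zero {M : CTMDP S A} {w : S → ℝ} {ρ b : ℝ}
    {Sl : ℕ → Set S} (hL : M.LyapunovCondition w ρ b Sl) (π : M.Policy) (γ : Measure S)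
    [IsProbabilityMeasure γ] (t : ℝ≥0) (N : ℕ) :
    law π γ {ω | mark 0 ω ∈ Sum.inl '' {x | w x ≤ N} ∧ ∀ n, jumpTime n ω ≤ t} = 0 := by
  set B : Set S := {x | w x ≤ N} with hBdef
  have hB : MeasurableSet B := hL.measurable_w measurableSet_Iic
  have hB0 : MeasurableSet (mark 0 ⁻¹' (Sum.inl '' B) : Set (Path S)) :=
    measurable_mark 0 (measurableSet_inl_image.2 hB)
  set p := law π γ {ω | mark 0 ω ∈ Sum.inl '' B ∧ ∀ n, jumpTime n ω ≤ t} with hp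
  set K : ℝ≥0∞ := ∫⁻ x in B, ENNReal.ofReal (growthBound ρ b t (w x)) ∂γ with hK
  have hKtop : K ≠ ⊤ := by
    have : K ≤ ∫⁻ x in B, ENNReal.ofReal (growthBound ρ b t N) ∂γ := by
      refine setLIntegral_mono' hB fun x hx => ENNReal.ofReal_le_ofReal ?_
      rw [growthBound_eq ρ b t (w x), growthBound_eq ρ b t N]
      have hx' : w x ≤ N := hx
      gcongr
    rw [setLIntegral_const] at this
    exact ne_top_of_le_ne_top (ENNReal.mul_ne_top ENNReal.ofReal_ne_top (measure_ne_top _ _)) this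
  have key : ∀ R : ℕ, R * p ≤ K := by
    intro R
    obtain ⟨l, hl⟩ : ∃ l, ∀ x ∉ Sl l, (R : ℝ) ≤ w x := by
      have := (hL.tendsto_iInf.eventually (lt_mem_nhds (EReal.coe_lt_top (R : ℝ)))).exists
      obtain ⟨l, hl⟩ := this
      refine ⟨l, fun x hx => ?_⟩
      exact_mod_cast hl.le.trans (iInf₂_le x hx)
    have hc := ENNReal.tendsto_atTop_zero_of_tsum_ne_top (hL.tsum_law_mark_mem_ne_top π γ t l)
    have hlim : Tendsto (fun n => R * law π γ {ω | jumpTime n ω ≤ t ∧ mark n ω ∈ Sum.inl '' Sl l} +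
        K) atTop (𝓝 K) := by
      simpa using (ENNReal.Tendsto.const_mul hc (Or.inr (ENNReal.natCast_ne_top R))).add_const K
    refine ge_of_tendsto' hlim fun n => ?_
    let D : Set (Path S) := {ω | jumpTime n ω ≤ t ∧ mark n ω ∈ Sum.inl '' (Sl l)ᶜ}
    have hD : MeasurableSet D := (measurable_jumpTime n measurableSet_Iic).inter
      (measurable_mark n (measurableSet_inl_image.2 (hL.measurableSet_Sl l).compl))
    have hsub : {ω : Path S | mark 0 ω ∈ Sum.inl '' B ∧ ∀ n, jumpTime n ω ≤ t} ⊆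
        {ω | jumpTime n ω ≤ t ∧ mark n ω ∈ Sum.inl '' Sl l} ∪
          (mark 0 ⁻¹' (Sum.inl '' B) ∩ D) := by
      rintro ω ⟨h0, hT⟩
      obtain ⟨x, hx⟩ := mark_eq_inl
        (ne_top_of_le_ne_top ENNReal.coe_ne_top ((sojourn_le_jumpTime n ω).trans (hT n)))
      by_cases hxl : x ∈ Sl l
      · exact Or.inl ⟨hT n, x, hxl, hx.symm⟩
      · exact Or.inr ⟨h0, hT n, x, hxl, hx.symm⟩
    have hmarkov : R * law π γ (mark 0 ⁻¹' (Sum.inl '' B) ∩ D) ≤ K := by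
      have h1 := le_add_self.trans (hL.sum_lintegral_occupation_add_le π γ hB n t)
      refine le_trans ?_ h1
      rw [← setLIntegral_const]
      refine (setLIntegral_mono' (hB0.inter hD) fun ω hω => ?_).trans
        (lintegral_mono_set Set.inter_subset_left)
      obtain ⟨-, hωt, x, hx, hxm⟩ := hω
      rw [remainder, Set.indicator_of_mem (by exact hωt), ← hxm]
      have hs : 0 ≤ (t : ℝ) - (jumpTime n ω).toReal := by
        have := ENNReal.toReal_mono ENNReal.coe_ne_top hωt
        simpa using this
      rw [← ENNReal.ofReal_natCast]
      exact ENNReal.ofReal_le_ofReal ((hl x hx).trans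
        (le_growthBound hL.rho_nonneg hL.b_nonneg hs (hL.w_nonneg x)))
    calc R * p ≤ R * (law π γ {ω | jumpTime n ω ≤ t ∧ mark n ω ∈ Sum.inl '' Sl l} +
          law π γ (mark 0 ⁻¹' (Sum.inl '' B) ∩ D)) := by
          gcongr
          exact (measure_mono hsub).trans (measure_union_le _ _)
      _ ≤ _ := by
          rw [mul_add]
          gcongr
  by_contra hp0
  obtain ⟨R, hR⟩ := ENNReal.exists_nat_mul_gt hp0 hKtop
  exact absurd (key R) (not_le.2 hR)

theorem LyapunovCondition.law_explosionTime_eq_top {M : CTMDP S A} {w : S → ℝ} {ρ b : ℝ}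
    {Sl : ℕ → Set S} (hL : M.LyapunovCondition w ρ b Sl) (π : M.Policy) (γ : Measure S)
    [IsProbabilityMeasure γ] : ∀ᵐ ω ∂law π γ, explosionTime ω = ⊤ := by
  have h : ∀ᵐ ω ∂law π γ, ∀ t N : ℕ,
      ¬(mark 0 ω ∈ Sum.inl '' {x | w x ≤ N} ∧ ∀ n, jumpTime n ω ≤ (t : ℝ≥0)) := by
    refine ae_all_iff.2 fun t => ae_all_iff.2 fun N => ?_
    have := hL.law_forall_jumpTime_le_eq_zero π γ t N
    rw [measure_eq_zero_iff_ae_notMem] at this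
    exact this
  filter_upwards [h] with ω hω
  by_contra hne
  obtain ⟨t, ht⟩ := ENNReal.exists_nat_gt hne
  obtain ⟨x, hx⟩ := ω.2.2.1
  obtain ⟨N, hN⟩ := exists_nat_ge (w x)
  exact hω t N ⟨⟨x, hN, hx⟩, fun n => (le_iSup (fun n => jumpTime n ω) n).trans
    (ht.le.trans_eq (by simp))⟩

theorem state_mem_range_inl {ω : Path S} (h : explosionTime ω = ⊤) (t : ℝ≥0) :
    state t ω ∈ Set.range Sum.inl := by
  have hex : ∃ n, (t : ℝ≥0∞) < jumpTime n ω :=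
    lt_iSup_iff.1 (h.symm ▸ ENNReal.coe_lt_top : (t : ℝ≥0∞) < explosionTime ω)
  classical
  obtain ⟨n, hn⟩ : ∃ n, Nat.find hex = n + 1 := by
    refine Nat.exists_eq_succ_of_ne_zero fun h0 => ?_
    have := Nat.find_spec hex
    rw [h0, jumpTime_zero] at this
    exact absurd this (by simp)
  have h1 : jumpTime n ω ≤ t := not_lt.1 (Nat.find_min hex (by omega))
  have h2 : (t : ℝ≥0∞) < jumpTime (n + 1) ω := hn ▸ Nat.find_spec hex
  obtain ⟨x, hx⟩ := mark_eq_inl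
    (ne_top_of_le_ne_top ENNReal.coe_ne_top ((sojourn_le_jumpTime n ω).trans h1))
  exact ⟨x, by rw [state_eq h1 h2, hx]⟩

end CTMDP

namespace CTMDP

/-! ### The lower bound of the performance functional -/

theorem neg_lintegral_le_eintegral {X : Type*} [MeasurableSpace X] (μ : Measure X)
    (f : X → EReal) :
    -((∫⁻ x, (-f x).toENNReal ∂μ : ℝ≥0∞) : EReal) ≤ eintegral μ f := by
  rw [eintegral, sub_eq_add_neg]
  exact le_add_of_nonneg_left (EReal.coe_ennreal_nonneg _)

theorem toENNReal_neg_eintegral_le {X : Type*} [MeasurableSpace X] (μ : Measure X)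
    (f : X → EReal) : (-eintegral μ f).toENNReal ≤ ∫⁻ x, (-f x).toENNReal ∂μ := by
  refine (EReal.toENNReal_le_toENNReal
    (EReal.neg_le_neg_iff.2 (neg_lintegral_le_eintegral μ f))).trans ?_
  rw [neg_neg, EReal.toENNReal_coe]

theorem toENNReal_le_abs (x : EReal) : x.toENNReal ≤ x.abs := by
  induction x with
  | bot => simp
  | top => simp
  | coe x => exact ENNReal.ofReal_le_ofReal (le_abs_self x)

variable {S A : Type*} [MeasurableSpace S] [MeasurableSpace A]

theorem CostCondition.neg_cost_le {M : CTMDP S A} {w : S → ℝ} {ρ α : ℝ} {γ : Measure S} {C c : ℝ}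
    (hC : M.CostCondition w ρ α γ C c) {x : S} {a : A} (ha : a ∈ M.adm x) :
    (-(M.cost x a : EReal)).toENNReal ≤ ENNReal.ofReal (C * w x + c) := by
  refine le_trans (EReal.toENNReal_le_toENNReal (EReal.neg_le_neg_iff.2
    (iInf₂_le (f := fun a (_ : a ∈ M.adm x) => (M.cost x a : EReal)) a ha)))
    (le_trans ?_ (hC.abs_iInf_cost_le x))
  rw [← EReal.abs_neg]
  exact toENNReal_le_abs _

theorem CostCondition.neg_costRate_le {M : CTMDP S A} {w : S → ℝ} {ρ α : ℝ} {γ : Measure S}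
    {C c : ℝ} (hC : M.CostCondition w ρ α γ C c) (hw : ∀ x, 0 ≤ w x) (π : M.Policy) (ω : Path S)
    (t : ℝ≥0) :
    (-costRate π ω t).toENNReal ≤
      ENNReal.ofReal C * extWeight w (leftState t ω) + ENNReal.ofReal c := by
  rw [costRate]
  have hconc := π.concentrated ω t
  have hprob := π.isProbabilityMeasure ω t
  have hinl : MeasurableEmbedding (Sum.inl : A → A ⊕ Unit) :=
    ⟨Sum.inl_injective, measurable_inl, fun _ hs => measurableSet_inl_image.2 hs⟩
  rcases hx : leftState t ω with x | x
  · simp only [extWeight, Sum.elim_inl]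
    rw [← ENNReal.ofReal_mul hC.C_nonneg, ← ENNReal.ofReal_add
      (mul_nonneg hC.C_nonneg (hw x)) hC.c_nonneg]
    refine (toENNReal_neg_eintegral_le _ _).trans ?_
    rw [hx] at hconc
    have hadm : ∀ᵐ a ∂(π.toFun ω t).comap Sum.inl, a ∈ M.adm x := by
      change (π.toFun ω t).comap Sum.inl (M.adm x)ᶜ = 0
      rw [hinl.comap_apply]
      refine measure_mono_null ?_ hconc
      rintro _ ⟨a, ha, rfl⟩ ⟨a', ha', h⟩
      exact ha (Sum.inl_injective h ▸ ha')
    refine (lintegral_mono_ae (hadm.mono fun a ha => hC.neg_cost_le ha)).trans ?_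
    rw [lintegral_const]
    refine mul_le_of_le_one_right' ?_
    rw [hinl.comap_apply]
    exact prob_le_one
  · simp

theorem CostCondition.le_discountedCost [StandardBorelSpace S] {M : CTMDP S A} {w : S → ℝ}
    {ρ b : ℝ} {Sl : ℕ → Set S} (hL : M.LyapunovCondition w ρ b Sl) (π : M.Policy) {γ : Measure S}
    [IsProbabilityMeasure γ] {α C c : ℝ} (hC : M.CostCondition w ρ α γ C c) :
    ((-(C * (α * (∫ y, w y ∂γ) + b) / (α * (α - ρ))) - c / α : ℝ) : EReal) ≤
        discountedCost π γ α := by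
  have hρ := hL.rho_nonneg
  have hb := hL.b_nonneg
  have hα : 0 < α := hρ.trans_lt hC.rho_lt
  have hαρ : 0 < α - ρ := sub_pos.2 hC.rho_lt
  have hw := hL.w_nonneg
  have hC0 := hC.C_nonneg
  have hc0 := hC.c_nonneg
  have hW : 0 ≤ ∫ y, w y ∂γ := integral_nonneg hw
  let I : Path S → ℝ≥0∞ := fun ω => ∫⁻ t in Set.Ioi (0 : ℝ), ENNReal.ofReal (Real.exp (-α * t)) *
    (ENNReal.ofReal C * extWeight w (state t.toNNReal ω) + ENNReal.ofReal c)
  have hI : ∀ ω, (-eintegral (volume.restrict (Set.Ioi (0 : ℝ))) fun t =>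
      (Real.exp (-α * t) : EReal) * costRate π ω t.toNNReal).toENNReal ≤ I ω := by
    intro ω
    refine (toENNReal_neg_eintegral_le _ _).trans (lintegral_mono_ae ?_)
    have hcount : (Set.range fun m => (jumpTime m ω).toReal).Countable := Set.countable_range _
    filter_upwards [ae_restrict_mem measurableSet_Ioi,
      ae_restrict_of_ae (hcount.ae_notMem volume)] with t ht htT
    rw [← leftState_eq_state (t := t.toNNReal) (ω := ω) fun m hm => htT ⟨m, by
      simp [hm, (Set.mem_Ioi.1 ht).le]⟩]
    rw [← mul_neg, EReal.toENNReal_mul (by exact_mod_cast (Real.exp_pos _).le),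
      EReal.toENNReal_of_ne_top (EReal.coe_ne_top _), EReal.toReal_coe]
    gcongr
    exact hC.neg_costRate_le hw π ω _
  have hS : Measurable fun p : Path S × ℝ => extWeight w (state p.2.toNNReal p.1) :=
    (measurable_extWeight_state hL.measurable_w).comp
      (measurable_fst.prodMk measurable_snd.real_toNNReal)
  have hJ : Measurable fun p : Path S × ℝ => ENNReal.ofReal (Real.exp (-α * p.2)) *
      (ENNReal.ofReal C * extWeight w (state p.2.toNNReal p.1) + ENNReal.ofReal c) :=
    (by fun_prop : Measurable fun p : Path S × ℝ => ENNReal.ofReal (Real.exp (-α * p.2))).mul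
      ((hS.const_mul _).add_const _)
  have hbound : ∀ t : ℝ, 0 < t → ∫⁻ ω, extWeight w (state t.toNNReal ω) ∂law π γ ≤
      ENNReal.ofReal (growthBound ρ b t (∫ y, w y ∂γ)) := by
    intro t ht
    refine (hL.lintegral_extWeight_state_le π γ t.toNNReal).trans_eq ?_
    rw [Real.coe_toNNReal t ht.le]
    simp_rw [growthBound_eq ρ b t (w _)]
    rw [← ofReal_integral_eq_lintegral_ofReal (f := fun x => Real.exp (ρ * t) * w x +
      growthBound ρ b t 0) ((hC.integrable_w.const_mul _).add (integrable_const _)), integral_add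
      (hC.integrable_w.const_mul _) (integrable_const _), integral_const_mul, integral_const,
      growthBound_eq ρ b t (∫ y, w y ∂γ)]
    · simp
    · refine ae_of_all _ fun x => ?_
      have := growthBound_zero_nonneg hρ hb ht.le
      have := hw x
      positivity
  have hexp : ∫⁻ t in Set.Ioi (0 : ℝ), ENNReal.ofReal (Real.exp (-α * t)) ≤
      ENNReal.ofReal (1 / α) := by
    have := lintegral_exp_mul_growthBound_le (ρ := 0) (b := 0) (v := 1) le_rfl le_rfl hα
      zero_le_one
    simp only [growthBound, zero_mul, Real.exp_zero, if_true, mul_one, add_zero, sub_zero,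
      ENNReal.ofReal_one] at this
    refine this.trans_eq ?_
    congr 1
    field_simp
  have hEI : ∫⁻ ω, I ω ∂law π γ ≤
      ENNReal.ofReal (C * (α * (∫ y, w y ∂γ) + b) / (α * (α - ρ)) + c / α) := by
    rw [lintegral_lintegral_swap hJ.aemeasurable]
    calc _ ≤ ∫⁻ t in Set.Ioi (0 : ℝ), (ENNReal.ofReal C * (ENNReal.ofReal (Real.exp (-α * t)) *
          ENNReal.ofReal (growthBound ρ b t (∫ y, w y ∂γ))) +
            ENNReal.ofReal c * ENNReal.ofReal (Real.exp (-α * t))) := by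
          refine setLIntegral_mono' measurableSet_Ioi fun t ht => ?_
          have hSt : Measurable fun ω : Path S => extWeight w (state t.toNNReal ω) :=
            hS.comp (measurable_id.prodMk measurable_const)
          rw [lintegral_const_mul _ ((hSt.const_mul _).add_const _),
            lintegral_add_right _ measurable_const, lintegral_const_mul _ hSt, lintegral_const,
            measure_univ, mul_one]
          grw [hbound t ht]
          exact le_of_eq (by ring)
      _ ≤ ENNReal.ofReal C * ENNReal.ofReal ((α * (∫ y, w y ∂γ) + b) / (α * (α - ρ))) +
            ENNReal.ofReal c * ENNReal.ofReal (1 / α) := by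
          rw [lintegral_add_right _ (by fun_prop), lintegral_const_mul' _ _ ENNReal.ofReal_ne_top,
            lintegral_const_mul' _ _ ENNReal.ofReal_ne_top]
          grw [hexp, lintegral_exp_mul_growthBound_le hρ hb hC.rho_lt hW]
      _ = _ := by
          rw [← ENNReal.ofReal_mul hC0, ← ENNReal.ofReal_mul hc0,
            ← ENNReal.ofReal_add (by positivity) (by positivity)]
          congr 1
          ring
  refine le_trans ?_ (neg_lintegral_le_eintegral _ _)
  have h := (lintegral_mono hI).trans hEI
  have h' := EReal.neg_le_neg_iff.2 (EReal.coe_ennreal_le_coe_ennreal_iff.2 h)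
  refine le_trans (le_of_eq ?_) h'
  rw [EReal.coe_ennreal_ofReal, max_eq_left (by positivity), ← EReal.coe_neg]
  congr 1
  ring

end CTMDP

theorem theorem1 {S A : Type*} [MeasurableSpace S] [StandardBorelSpace S]
    [MeasurableSpace A] [StandardBorelSpace A] (M : CTMDP S A)
    (w : S → ℝ) (ρ b : ℝ) (Sl : ℕ → Set S) (hL : M.LyapunovCondition w ρ b Sl) (π : M.Policy) :
    ((∀ (γ : Measure S) [IsProbabilityMeasure γ],
        CTMDP.law π γ {ω | CTMDP.explosionTime ω = ⊤} = 1 ∧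
          ∀ t : ℝ≥0, CTMDP.law π γ {ω | CTMDP.state t ω ∈ Set.range Sum.inl} = 1) ∧
      ∀ (x : S) (t : ℝ≥0),
        ∫⁻ ω, Sum.elim (fun y => ENNReal.ofReal (w y)) (fun _ => 0) (CTMDP.state t ω)
            ∂CTMDP.law π (Measure.dirac x) ≤
          ENNReal.ofReal (if ρ = 0 then w x + b * t
            else Real.exp (ρ * t) * w x + b / ρ * (Real.exp (ρ * t) - 1))) ∧
    ∀ (γ : Measure S) [IsProbabilityMeasure γ] (α C c : ℝ), M.CostCondition w ρ α γ C c →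
      ((-(C * (α * (∫ y, w y ∂γ) + b) / (α * (α - ρ))) - c / α : ℝ) : EReal) ≤
        CTMDP.discountedCost π γ α := by
  refine ⟨⟨fun γ _ => ?_, fun x t => ?_⟩, fun γ _ α C c hC => hC.le_discountedCost hL π⟩
  · have h := hL.law_explosionTime_eq_top π γ
    exact ⟨(measure_congr (eventuallyEq_univ.2 h)).trans measure_univ, fun t =>
      (measure_congr (eventuallyEq_univ.2
        (h.mono fun ω hω => CTMDP.state_mem_range_inl hω t))).trans measure_univ⟩
  · refine (hL.lintegral_extWeight_state_le π (Measure.dirac x) t).trans_eq ?_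
    have hm : Measurable fun x => ENNReal.ofReal (CTMDP.growthBound ρ b t (w x)) :=
      ((CTMDP.continuous_growthBound ρ b).measurable.comp
        (measurable_const.prodMk hL.measurable_w)).ennreal_ofReal
    rw [lintegral_dirac' _ hm, CTMDP.growthBound]
    split_ifs with hρ <;> simp [hρ]
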